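/- Let $n\ge 2$, let $G=S_n$ and let $C$ be the conjugacy class of transpositions. For a finite-dimensional complex representation $\tau$ of $S_n$ with character $\chi^\tau$, and conjugacy classes $K$, put $a_\tau=1-\frac{\chi^\tau(C)}{\dim\tau}$ and let $p_2(K)$ be the probability that the random walk on $S_n$ started at the identity, with steps $g\mapsto gh$, $h$ uniform in $C$, is in $K$ after two steps. For a nontrivial irreducible $\tau$, the error term associated to $\tau$ is $$E(\tau)=|C|\sqrt{\sum_{K\neq \mathrm{id}}\frac{p_2(K)^2}{|K|}\left(\frac{\frac{\chi^\tau(K)}{\dim\tau}-1}{a_\tau}+2\right)^2}+\left[\frac{|C|^2}{\pi}\sum_{K}\frac{p_2(K)^2}{|K|}\left(8+6\,\frac{\frac{\chi^\tau(K)}{\dim\tau}-1}{a_\tau}\right)\right]^{1/4},$$ the sums being over the conjugacy classes $K$ of $S_n$. (This is the right-hand side of Fulman's normal approximation bound for $W(\lambda)=|C|^{1/2}\chi^\lambda(C)/\dim\lambda$ under the Plancherel measure of $S_n$, obtained from the exchangeable pair given by the Markov chain $L_\tau(\lambda,\rho)=\frac{\dim\rho}{\dim\lambda\,\dim\tau}\frac1{n!}\sum_{g\in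 S_n}\chi^\lambda(g)\chi^\tau(g)\overline{\chi^\rho(g)}$.) Index the irreducible representations of $S_n$ by the partitions of $n$ through Specht modules, so that $(n)$ is the trivial representation. For partitions $\lambda=(\lambda_1,\dots,\lambda_k)$ (with $\lambda_k>0$) and $\mu=(\mu_1,\dots,\mu_m)$ of $n$, write $\lambda\succ\mu$ if $\lambda_1\ge\mu_1$, $\lambda_i=\mu_i$ for $2\le i\le k-1$, and $\lambda_k\le\mu_k$, where $\mu_i=0$ for $i>m$. Then: 1. If $\lambda$ and $\mu$ are nontrivial and $\lambda\succ\mu$, then $E(\lambda)\le E(\mu)$. 2. In particular, the error term is minimal at $(n-1,1)$: the representation $(n-1,1)$ is irreducible and nontrivial, and $E((n-1,1))\le E(\tau)$ for every nontrivial irreducible complex representation $\tau$ of $S_n$. -/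

import Mathlib

noncomputable section

namespace FulmanBound

section Group

variable {G : Type*} [Group G] [Fintype G] [DecidableEq G]

/-- The number of elements of a conjugacy class, as a real number. -/
def classSize (K : ConjClasses G) : ℝ := (K.carrier.toFinset.card : ℝ)

/-- Law after `t` steps of the random walk on `G` generated by the conjugacy class `C` and started
at the identity: one step goes from `g` to `g * h`, with `h` uniform in `C`. -/
def walkLaw (C : ConjClasses G) : ℕ → G → ℝ
  | 0, g => if g = 1 then 1 else 0
  | t + 1, g => ∑ h ∈ C.carrier.toFinset, (1 / classSize C) * walkLaw C t (g * h⁻¹)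

/-- `p₂(K)`: the probability that this walk is in the conjugacy class `K` after two steps. -/
def p₂ (C K : ConjClasses G) : ℝ := ∑ g ∈ K.carrier.toFinset, walkLaw C 2 g

/-- The character ratio `χ(K) / dim V` of a complex representation at a conjugacy class. (The real
part only serves to view it as a real number: the bound below is for real-valued characters, and
all characters of symmetric groups are real-valued.) -/
def charRatio {V : Type*} [AddCommGroup V] [Module ℂ V] (ρ : Representation ℂ G V)
    (K : ConjClasses G) : ℝ :=
  Quotient.lift (s := IsConj.setoid G)
    (fun g : G => (ρ.character g).re / (Module.finrank ℂ V : ℝ))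
    (by
      intro a b hab
      obtain ⟨c, hc⟩ := isConj_iff.1 (show IsConj a b from hab)
      have : ρ.character b = ρ.character a := by rw [← hc, Representation.char_conj]
      simp only [this]) K

/-- `a_τ = 1 - χ^τ(C) / dim τ`. -/
def aCoeff {V : Type*} [AddCommGroup V] [Module ℂ V] (C : ConjClasses G)
    (τ : Representation ℂ G V) : ℝ := 1 - charRatio τ C

/-- `T_K(τ) = (χ^τ(K) / dim τ - 1) / a_τ`. -/
def tTerm {V : Type*} [AddCommGroup V] [Module ℂ V] (C : ConjClasses G)
    (τ : Representation ℂ G V) (K : ConjClasses G) : ℝ :=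
  (charRatio τ K - 1) / aCoeff C τ

/-- The error term of Fulman's normal approximation theorem for
`W(lam) = |C|^{1/2} χ^lam(C) / dim lam` under the Plancherel measure of `G`, when the exchangeable
pair comes from the chain `L_τ`. -/
def errorTerm {V : Type*} [AddCommGroup V] [Module ℂ V] (C : ConjClasses G)
    (τ : Representation ℂ G V) : ℝ :=
  classSize C *
      Real.sqrt (∑ K ∈ Finset.univ.erase (ConjClasses.mk (1 : G)),
        p₂ C K ^ 2 / classSize K * (tTerm C τ K + 2) ^ 2) +
    (classSize C ^ 2 / Real.pi *
      ∑ K : ConjClasses G, p₂ C K ^ 2 / classSize K * (8 + 6 * tTerm C τ K)) ^ (1 / 4 : ℝ)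

end Group

section Specht

/-- Tableaux of shape `lam`: the entries `0, …, n - 1` are placed bijectively in the cells.
(There are none unless `lam` has exactly `n` cells.) -/
abbrev Tableau (n : ℕ) (lam : YoungDiagram) : Type := Fin n ≃ lam.cells

/-- The tabloid of a tableau (its rows as unordered sets), recorded as the function sending each
entry to the index of its row. -/
def tabloid {n : ℕ} {lam : YoungDiagram} (T : Tableau n lam) : Fin n → ℕ := fun i => (T i).1.1

/-- The column stabilizer of a tableau. -/
def colStabilizer {n : ℕ} {lam : YoungDiagram} (T : Tableau n lam) :
    Finset (Equiv.Perm (Fin n)) :=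
  Finset.univ.filter fun σ => ∀ i, (T (σ i)).1.2 = (T i).1.2

/-- The action of `S_n` on the free complex vector space on row assignments `Fin n → ℕ`, by
permuting entries: after applying `σ`, the entry `σ i` is in the row where `i` was. It contains
all permutation modules on tabloids. -/
def entryRep (n : ℕ) : Representation ℂ (Equiv.Perm (Fin n)) ((Fin n → ℕ) →₀ ℂ) where
  toFun σ := Finsupp.lmapDomain ℂ ℂ (fun f : Fin n → ℕ => f ∘ (σ⁻¹ : Equiv.Perm (Fin n)))
  map_one' := by
    ext f : 2
    simp [Finsupp.lmapDomain_apply]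
  map_mul' σ τ := by
    ext f : 2
    simp [Function.comp_def]

/-- The polytabloid of `T`: the signed sum of the tabloids `σ • {T}` over the column stabilizer. -/
def polytabloid {n : ℕ} {lam : YoungDiagram} (T : Tableau n lam) : (Fin n → ℕ) →₀ ℂ :=
  ∑ σ ∈ colStabilizer T,
    ((Equiv.Perm.sign σ : ℤ) : ℂ) • entryRep n σ (Finsupp.single (tabloid T) 1)

/-- The Specht module of shape `lam`: the span of the polytabloids. -/
def spechtModule (n : ℕ) (lam : YoungDiagram) : Submodule ℂ ((Fin n → ℕ) →₀ ℂ) :=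
  Submodule.span ℂ (Set.range (polytabloid : Tableau n lam → _))

theorem entryRep_polytabloid {n : ℕ} {lam : YoungDiagram} (σ : Equiv.Perm (Fin n))
    (T : Tableau n lam) :
    entryRep n σ (polytabloid T) = polytabloid ((σ⁻¹ : Equiv.Perm (Fin n)).trans T) := by
  have key : entryRep n σ (Finsupp.single (tabloid T) 1) =
      Finsupp.single (tabloid ((σ⁻¹ : Equiv.Perm (Fin n)).trans T)) 1 := by
    change Finsupp.mapDomain _ (Finsupp.single (tabloid T) (1 : ℂ)) = _
    rw [Finsupp.mapDomain_single]
    rfl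
  unfold polytabloid
  rw [map_sum]
  refine Finset.sum_bij' (fun π _ => σ * π * σ⁻¹) (fun π _ => σ⁻¹ * π * σ) ?_ ?_ ?_ ?_ ?_
  · intro π hπ
    simp only [colStabilizer, Finset.mem_filter, Finset.mem_univ, true_and] at hπ ⊢
    intro i
    simpa using hπ (σ⁻¹ i)
  · intro π hπ
    simp only [colStabilizer, Finset.mem_filter, Finset.mem_univ, true_and] at hπ ⊢
    intro i
    simpa using hπ (σ i)
  · intro π _
    group
  · intro π _
    group
  · intro π _
    rw [map_smul, ← key, ← Module.End.mul_apply, ← Module.End.mul_apply, ← map_mul, ← map_mul]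
    have hs : ((Equiv.Perm.sign (σ * π * σ⁻¹) : ℤ) : ℂ) = ((Equiv.Perm.sign π : ℤ) : ℂ) := by
      rw [Equiv.Perm.sign_mul, Equiv.Perm.sign_mul, Equiv.Perm.sign_inv, mul_right_comm,
        Int.units_mul_self, one_mul]
    rw [hs, inv_mul_cancel_right]

theorem spechtModule_le_comap (n : ℕ) (lam : YoungDiagram) (σ : Equiv.Perm (Fin n)) :
    spechtModule n lam ≤ (spechtModule n lam).comap (entryRep n σ) := by
  refine Submodule.span_le.2 ?_
  rintro _ ⟨T, rfl⟩
  change entryRep n σ (polytabloid T) ∈ spechtModule n lam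
  rw [entryRep_polytabloid]
  exact Submodule.subset_span ⟨_, rfl⟩

/-- The irreducible representation of `S_n` indexed by the partition `lam` of `n`: the action of
`S_n` on the Specht module. -/
def spechtRep (n : ℕ) (lam : YoungDiagram) :
    Representation ℂ (Equiv.Perm (Fin n)) (spechtModule n lam) :=
  (entryRep n).subrepresentation (spechtModule n lam) (spechtModule_le_comap n lam)

end Specht

/-- The succession order on partitions. With `k = lam.colLen 0` the number of parts of `lam`, and
parts numbered from `1`: `lam_1 ≥ mu_1`, `lam_i = mu_i` for `2 ≤ i ≤ k - 1`, and `lam_k ≤ mu_k`.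
(`rowLen` numbers the parts from `0` and is `0` beyond the last one.) -/
def Succeeds (lam mu : YoungDiagram) : Prop :=
  mu.rowLen 0 ≤ lam.rowLen 0 ∧
  (∀ i, 1 ≤ i → i + 1 < lam.colLen 0 → lam.rowLen i = mu.rowLen i) ∧
  lam.rowLen (lam.colLen 0 - 1) ≤ mu.rowLen (lam.colLen 0 - 1)

/-- The partition `(n - 1, 1)` of `n`, for `n ≥ 2`. -/
def standardShape (n : ℕ) (hn : 2 ≤ n) : YoungDiagram :=
  YoungDiagram.ofRowLens [n - 1, 1] (by
    refine List.Pairwise.sortedGE ?_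
    simp
    omega)

/-- The conjugacy class of transpositions in `S_n`, for `n ≥ 2`. -/
def transpositions (n : ℕ) (hn : 2 ≤ n) : ConjClasses (Equiv.Perm (Fin n)) :=
  ConjClasses.mk (Equiv.swap ⟨0, by omega⟩ ⟨1, by omega⟩)

end FulmanBound

end

noncomputable section

namespace FulmanBound

/-! ### The two-step walk and monotonicity of the error term in T_K. -/

section Group

variable {G : Type*} [Group G] [Fintype G] [DecidableEq G]

/-! Write T_K(τ) = (χ^τ(K)/dim τ - 1)/a_τ. Only products of two transpositions carry mass under p₂:
the identity, where T = 0, the 3-cycles and the double transpositions. The error term is monotone in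
the two remaining values of T as long as the smaller values are at least -2 and their fourth-root
radicand is nonnegative (`errorTerm_le_errorTerm`, `sum_fourth_moment_nonneg`). Both claims thus
reduce to comparing T at two classes.

Minimality. For any nontrivial τ the signed averages over S_3 and over S_2 × S_2 act as projections,
whose traces are nonnegative; this reads T ≥ -3/2 at 3-cycles and T ≥ -2 at double transpositions.
The shape (n - 1, 1) attains both bounds, so minimality does not depend on the succession order.

Monotonicity. The sums of all transpositions and of all 3-cycles act on a Specht module by scalars,
read off by applying a column antisymmetrizer to a moved tabloid; squaring the transposition sum
gives the double transpositions. With the normalized defects D = `swapDefect` and Q =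
`threeCycleDefect`, T is -3/(2(n - 2)) · Q/D at 3-cycles and an increasing affine function of D +
3Q/D at double transpositions. Row by row, D = ∑ d_i and Q = ∑ s_i d_i with d_i ≥ 0 and s_i
decreasing, so Q/D is a weighted mean of the s_i. If λ ≻ μ, then μ has the weights of λ before the
last row of λ, and only gains weight from that row on, where s is smallest. Hence Q/D does not
increase. Yet D + 3Q/D does not decrease, because 3(s_0 - s_j) ≤ D(μ) whenever d_j(μ) ≠ 0
(`three_mul_le_swapDefect`, `defects_of_succeeds`). -/

theorem classSize_pos (K : ConjClasses G) : 0 < classSize K := by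
  obtain ⟨g, rfl⟩ := ConjClasses.exists_rep K
  unfold classSize
  rw [Nat.cast_pos, Finset.card_pos]
  exact ⟨g, by simp [ConjClasses.mem_carrier_iff_mk_eq]⟩

theorem walkLaw_one (C : ConjClasses G) (g : G) :
    walkLaw C 1 g = if ConjClasses.mk g = C then 1 / classSize C else 0 := by
  simp only [walkLaw, mul_inv_eq_one]
  by_cases h : ConjClasses.mk g = C
  · rw [if_pos h, Finset.sum_eq_single g]
    · simp
    · intro b _ hb
      simp [Ne.symm hb]
    · intro hg
      exact absurd (by simpa [ConjClasses.mem_carrier_iff_mk_eq] using h) hg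
  · rw [if_neg h]
    refine Finset.sum_eq_zero fun b hb => ?_
    rw [if_neg, mul_zero]
    rintro rfl
    exact h (by simpa [ConjClasses.mem_carrier_iff_mk_eq] using hb)

/-- The steps `h` of the walk such that `g * h⁻¹` is again a step. -/
def twoStepFactors (C : ConjClasses G) (g : G) : Finset G :=
  Finset.univ.filter fun h => ConjClasses.mk h = C ∧ ConjClasses.mk (g * h⁻¹) = C

theorem walkLaw_two (C : ConjClasses G) (g : G) :
    walkLaw C 2 g = ((twoStepFactors C g).card : ℝ) / classSize C ^ 2 := by
  rw [walkLaw]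
  simp only [walkLaw_one]
  have : C.carrier.toFinset = Finset.univ.filter fun h => ConjClasses.mk h = C := by
    ext h
    simp [ConjClasses.mem_carrier_iff_mk_eq]
  rw [this]
  simp only [mul_ite, mul_zero]
  rw [← Finset.sum_filter, Finset.filter_filter, Finset.sum_const, twoStepFactors, nsmul_eq_mul]
  ring

theorem walkLaw_nonneg (C : ConjClasses G) (t : ℕ) (g : G) : 0 ≤ walkLaw C t g := by
  induction t generalizing g with
  | zero => simp only [walkLaw]; split_ifs <;> norm_num
  | succ t ih =>
    rw [walkLaw]
    exact Finset.sum_nonneg fun h _ =>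
      mul_nonneg (div_nonneg zero_le_one (classSize_pos C).le) (ih _)

theorem sum_walkLaw (C : ConjClasses G) (t : ℕ) : ∑ g, walkLaw C t g = 1 := by
  induction t with
  | zero => simp [walkLaw]
  | succ t ih =>
    simp only [walkLaw]
    rw [Finset.sum_comm]
    have : ∀ h : G, ∑ g, 1 / classSize C * walkLaw C t (g * h⁻¹) = 1 / classSize C := by
      intro h
      have := Fintype.sum_equiv (Equiv.mulRight h⁻¹) (fun g => walkLaw C t (g * h⁻¹)) (walkLaw C t)
        (fun _ => rfl)
      rw [← Finset.mul_sum, this, ih, mul_one]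
    simp only [this, Finset.sum_const, nsmul_eq_mul]
    exact mul_one_div_cancel (classSize_pos C).ne'

theorem p₂_nonneg (C K : ConjClasses G) : 0 ≤ p₂ C K :=
  Finset.sum_nonneg fun _ _ => walkLaw_nonneg C 2 _

theorem sum_p₂ (C : ConjClasses G) : ∑ K, p₂ C K = 1 := by
  rw [← sum_walkLaw C 2, ← Finset.sum_fiberwise (s := Finset.univ)
    (g := fun g : G => ConjClasses.mk g) (f := walkLaw C 2)]
  refine Finset.sum_congr rfl fun K _ => Finset.sum_congr ?_ fun _ _ => rfl
  ext h
  simp [ConjClasses.mem_carrier_iff_mk_eq]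

theorem exists_mem_twoStepFactors_of_p₂_ne_zero {C K : ConjClasses G} (h : p₂ C K ≠ 0) :
    ∃ g, ConjClasses.mk g = K ∧ (twoStepFactors C g).Nonempty := by
  obtain ⟨g, hg, hne⟩ := Finset.exists_ne_zero_of_sum_ne_zero h
  refine ⟨g, by simpa [ConjClasses.mem_carrier_iff_mk_eq] using hg, ?_⟩
  rw [walkLaw_two] at hne
  rw [← Finset.card_pos]
  by_contra h0
  apply hne
  simp [Nat.eq_zero_of_not_pos h0]

/-- Each element of K has walk probability at most b/|C|², so p₂(K)/|K| is at most that; the other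
factor p₂(K) is kept so that the bounds can be summed over K. -/
theorem p₂_sq_div_le {C K : ConjClasses G} {b : ℕ}
    (h : ∀ g, ConjClasses.mk g = K → (twoStepFactors C g).card ≤ b) :
    p₂ C K ^ 2 / classSize K ≤ p₂ C K * (b / classSize C ^ 2) := by
  have hK := classSize_pos K
  have hle : p₂ C K ≤ classSize K * (b / classSize C ^ 2) := by
    unfold p₂
    rw [classSize, ← nsmul_eq_mul]
    refine Finset.sum_le_card_nsmul _ _ _ fun g hg => ?_
    rw [walkLaw_two]
    gcongr
    exact h g (by simpa [ConjClasses.mem_carrier_iff_mk_eq] using hg)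
  rw [div_le_iff₀ hK]
  nlinarith [p₂_nonneg C K]

theorem p₂_mk_one (C : ConjClasses G) (hC : ∀ g, ConjClasses.mk g = C → ConjClasses.mk g⁻¹ = C) :
    p₂ C (ConjClasses.mk 1) = 1 / classSize C := by
  have hcar : (ConjClasses.mk (1 : G)).carrier.toFinset = {1} := by
    ext h
    simp [ConjClasses.mem_carrier_iff_mk_eq, ConjClasses.mk_eq_mk_iff_isConj]
  have hf : twoStepFactors C 1 = C.carrier.toFinset := by
    ext h
    simp only [twoStepFactors, Finset.mem_filter, Finset.mem_univ, true_and, one_mul,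
      Set.mem_toFinset, ConjClasses.mem_carrier_iff_mk_eq]
    exact ⟨fun h => h.1, fun h => ⟨h, hC _ h⟩⟩
  unfold p₂
  rw [hcar, Finset.sum_singleton, walkLaw_two, hf]
  change classSize C / classSize C ^ 2 = _
  have := (classSize_pos C).ne'
  field_simp

theorem classSize_mk_one : classSize (ConjClasses.mk (1 : G)) = 1 := by
  have hcar : (ConjClasses.mk (1 : G)).carrier.toFinset = {1} := by
    ext h
    simp [ConjClasses.mem_carrier_iff_mk_eq, ConjClasses.mk_eq_mk_iff_isConj]
  rw [classSize, hcar]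
  simp

variable {V W : Type*} [AddCommGroup V] [Module ℂ V] [AddCommGroup W] [Module ℂ W]

omit [Fintype G] [DecidableEq G] in
theorem charRatio_mk (ρ : Representation ℂ G V) (g : G) :
    charRatio ρ (ConjClasses.mk g) = (ρ.character g).re / (Module.finrank ℂ V : ℝ) := rfl

omit [Fintype G] [DecidableEq G] in
theorem tTerm_mk_one [FiniteDimensional ℂ V] [Nontrivial V] (C : ConjClasses G)
    (ρ : Representation ℂ G V) : tTerm C ρ (ConjClasses.mk 1) = 0 := by
  have : (Module.finrank ℂ V : ℝ) ≠ 0 := by exact_mod_cast Module.finrank_pos.ne'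
  rw [tTerm, charRatio_mk, Representation.char_one, Complex.natCast_re, div_self this, sub_self,
    zero_div]

/-- The bound T ≥ -2 makes T + 2 nonnegative, so squaring preserves order in the first sum. The
second sum is affine in T with nonnegative coefficients, and the identity contributes equally to
both sides. Monotonicity of the fourth root needs the smaller radicand to be nonnegative, which is
`hpos`. -/
theorem errorTerm_le_errorTerm [FiniteDimensional ℂ V] [Nontrivial V] [FiniteDimensional ℂ W]
    [Nontrivial W] (C : ConjClasses G) (τ : Representation ℂ G V) (τ' : Representation ℂ G W)
    (hpos : 0 ≤ ∑ K : ConjClasses G, p₂ C K ^ 2 / classSize K * (8 + 6 * tTerm C τ K))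
    (h : ∀ K, K ≠ ConjClasses.mk 1 → p₂ C K ≠ 0 →
      -2 ≤ tTerm C τ K ∧ tTerm C τ K ≤ tTerm C τ' K) :
    errorTerm C τ ≤ errorTerm C τ' := by
  have hc : ∀ K : ConjClasses G, 0 ≤ p₂ C K ^ 2 / classSize K := fun K =>
    div_nonneg (sq_nonneg _) (classSize_pos K).le
  have hsum : (∑ K : ConjClasses G, p₂ C K ^ 2 / classSize K * (8 + 6 * tTerm C τ K) ≤
      ∑ K : ConjClasses G, p₂ C K ^ 2 / classSize K * (8 + 6 * tTerm C τ' K)) := by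
    refine Finset.sum_le_sum fun K _ => ?_
    by_cases hK : K = ConjClasses.mk 1
    · subst hK
      rw [tTerm_mk_one, tTerm_mk_one]
    by_cases hp : p₂ C K = 0
    · simp [hp]
    exact mul_le_mul_of_nonneg_left (by linarith [(h K hK hp).2]) (hc K)
  unfold errorTerm
  refine add_le_add (mul_le_mul_of_nonneg_left (Real.sqrt_le_sqrt ?_) (classSize_pos C).le) ?_
  · refine Finset.sum_le_sum fun K hK => ?_
    by_cases hp : p₂ C K = 0
    · simp [hp]
    have := h K (Finset.ne_of_mem_erase hK) hp
    refine mul_le_mul_of_nonneg_left ?_ (hc K)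
    exact pow_le_pow_left₀ (by linarith) (by linarith) 2
  · have hCpi : 0 ≤ classSize C ^ 2 / Real.pi := div_nonneg (sq_nonneg _) Real.pi_pos.le
    exact Real.rpow_le_rpow (mul_nonneg hCpi hpos) (mul_le_mul_of_nonneg_left hsum hCpi)
      (by norm_num)

end Group

/-! ### Character inequalities from traces of sign projections. -/

theorem re_trace_nonneg_of_isIdempotentElem {V : Type*} [AddCommGroup V] [Module ℂ V]
    [FiniteDimensional ℂ V] {f : Module.End ℂ V} (hf : IsIdempotentElem f) :
    0 ≤ (LinearMap.trace ℂ V f).re := by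
  rw [(LinearMap.IsIdempotentElem.isProj_range f hf).trace, Complex.natCast_re]
  positivity

section SymmetricGroup

open Equiv Equiv.Perm

variable {α : Type*} [Fintype α] [DecidableEq α]

theorem isConj_swap_mul_swap_same {a b c a' b' c' : α} (hab : a ≠ b) (hac : a ≠ c) (hbc : b ≠ c)
    (hab' : a' ≠ b') (hac' : a' ≠ c') (hbc' : b' ≠ c') :
    IsConj (swap a b * swap a c) (swap a' b' * swap a' c') :=
  (isConj_iff_cycleType_eq).2 ((isThreeCycle_swap_mul_swap_same hab hac hbc).cycleType.trans
    (isThreeCycle_swap_mul_swap_same hab' hac' hbc').cycleType.symm)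

theorem isConj_swap_mul_swap {a b c d a' b' c' d' : α} (h : [a, b, c, d].Nodup)
    (h' : [a', b', c', d'].Nodup) : IsConj (swap a b * swap c d) (swap a' b' * swap c' d') :=
  (isConj_iff_cycleType_eq).2 ((cycleType_swap_mul_swap_of_nodup h).trans
    (cycleType_swap_mul_swap_of_nodup h').symm)

section Representation

variable {V : Type*} [AddCommGroup V] [Module ℂ V]
  (ρ : Representation ℂ (Perm α) V)

theorem character_eq_of_isConj {G : Type*} [Group G] (ρ : Representation ℂ G V) {g h : G}
    (hc : IsConj g h) : ρ.character g = ρ.character h := by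
  obtain ⟨c, hc⟩ := isConj_iff.1 hc
  rw [← hc, Representation.char_conj]

theorem isTrivial_of_swap {a b : α} (hab : a ≠ b) (h : ρ (swap a b) = 1) : ρ.IsTrivial := by
  have key : ∀ c d : α, c ≠ d → ρ (swap c d) = 1 := by
    intro c d hcd
    obtain ⟨σ, hσ⟩ := isConj_iff.1 (isConj_swap hab hcd)
    rw [← hσ, map_mul, map_mul, h, mul_one, ← map_mul, mul_inv_cancel, map_one]
  refine ⟨fun g => ?_⟩
  change ρ g = 1
  induction g using swap_induction_on with
  | one => exact map_one ρ
  | swap_mul f x y hxy ih => rw [map_mul, key x y hxy, ih, one_mul]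

/-- The difference dim V - χ(s) is twice the rank of the projection (1 - s)/2. Rank zero would make
one transposition act trivially, hence all of them, and they generate. -/
theorem character_swap_lt_finrank [FiniteDimensional ℂ V] {a b : α} (hab : a ≠ b)
    (hρ : ¬ ρ.IsTrivial) : (ρ.character (swap a b)).re < Module.finrank ℂ V := by
  set s := ρ (swap a b) with hs
  have hss : s * s = 1 := by rw [hs, ← map_mul, swap_mul_self, map_one]
  have hidem : IsIdempotentElem ((1 / 2 : ℂ) • (1 - s)) := by
    change ((1 / 2 : ℂ) • (1 - s)) * ((1 / 2 : ℂ) • (1 - s)) = _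
    rw [smul_mul_smul_comm, mul_sub, sub_mul, sub_mul, hss]
    simp only [one_mul, mul_one]
    module
  have htr : LinearMap.trace ℂ V ((1 / 2 : ℂ) • (1 - s)) =
      1 / 2 * (Module.finrank ℂ V - ρ.character (swap a b)) := by
    rw [map_smul, map_sub, LinearMap.trace_one, smul_eq_mul]
    rfl
  have hp := (LinearMap.IsIdempotentElem.isProj_range _ hidem).trace
  have hchar : ρ.character (swap a b) = Module.finrank ℂ V -
      2 * (Module.finrank ℂ (LinearMap.range ((1 / 2 : ℂ) • (1 - s))) : ℂ) := by
    rw [← hp, htr]; ring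
  have hre : (ρ.character (swap a b)).re = Module.finrank ℂ V -
      2 * (Module.finrank ℂ (LinearMap.range ((1 / 2 : ℂ) • (1 - s))) : ℝ) := by
    rw [hchar]; simp
  rw [hre, sub_lt_self_iff]
  refine mul_pos two_pos ?_
  rw [Nat.cast_pos, Nat.pos_iff_ne_zero]
  intro h0
  rw [Submodule.finrank_eq_zero, LinearMap.range_eq_bot, smul_eq_zero] at h0
  rcases h0 with hr | hr
  · norm_num at hr
  · exact hρ (isTrivial_of_swap ρ hab (sub_eq_zero.1 hr).symm)

omit [Fintype α] in
/-- The trace of the projection on the vectors on which the symmetric group of three points acts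
by the sign is nonnegative. -/
theorem character_swap_mul_swap_same_ge [FiniteDimensional ℂ V] {a b c : α} (hab : a ≠ b)
    (hac : a ≠ c) (hbc : b ≠ c) :
    3 * (ρ.character (swap a b)).re ≤
      Module.finrank ℂ V + 2 * (ρ.character (swap a b * swap a c)).re := by
  have hbraid : swap a b * swap a c * swap a b = swap a c * swap a b * swap a c := by
    rw [swap_comm a c, swap_mul_swap_mul_swap hac.symm hbc.symm, swap_comm c a, swap_comm a b,
      swap_mul_swap_mul_swap hab.symm hbc, swap_comm]
  have hχ := character_eq_of_isConj ρ (isConj_swap hab hac)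
  set s := ρ (swap a b) with hs
  set t := ρ (swap a c) with ht
  have hss : s * s = 1 := by rw [hs, ← map_mul, swap_mul_self, map_one]
  have htt : t * t = 1 := by rw [ht, ← map_mul, swap_mul_self, map_one]
  have hst : s * t * s = t * s * t := by simp only [hs, ht, ← map_mul, hbraid]
  -- The signed sum over the copy of S_3 on a, b, c; the braid relation makes `s * t * s` the third
  -- transposition, and A² = 6A follows from sA = tA = -A.
  set A := 1 - s - t - s * t * s + s * t + t * s with hA
  have hsA : s * A = -A := by
    have : s * A = s - s * s - s * t - (s * s) * t * s + (s * s) * t + s * t * s := by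
      rw [hA]; noncomm_ring
    rw [this, hss, hA]; noncomm_ring
  have htA : t * A = -A := by
    have : t * A = t - t * s - t * t - (t * s * t) * s + (t * t) * s + t * s * t := by
      rw [hA]; noncomm_ring
    rw [this, htt, ← hst, mul_assoc (s * t) s s, hss, hA]; noncomm_ring
  have hAA : A * A = (6 : ℂ) • A := by
    nth_rewrite 1 [hA]
    have : (1 - s - t - s * t * s + s * t + t * s) * A =
      A - s * A - t * A - s * (t * (s * A)) + s * (t * A) + t * (s * A) := by noncomm_ring
    rw [this]
    simp only [hsA, htA, mul_neg]
    module
  have hidem : IsIdempotentElem ((1 / 6 : ℂ) • A) := by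
    change ((1 / 6 : ℂ) • A) * ((1 / 6 : ℂ) • A) = _
    rw [smul_mul_smul_comm, hAA, smul_smul]
    norm_num
  have htr : LinearMap.trace ℂ V ((1 / 6 : ℂ) • A) = ((1 / 6 : ℝ) : ℂ) *
      (Module.finrank ℂ V + ((2 : ℝ) : ℂ) * ρ.character (swap a b * swap a c) -
        ((3 : ℝ) : ℂ) * ρ.character (swap a b)) := by
    have e1 : LinearMap.trace ℂ V (s * t * s) = ρ.character (swap a b) := by
      rw [LinearMap.trace_mul_comm, ← mul_assoc, hss, one_mul, hχ]
      rfl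
    have e2 : LinearMap.trace ℂ V (s * t) = ρ.character (swap a b * swap a c) := by
      rw [hs, ht, ← map_mul]
      rfl
    have e3 : LinearMap.trace ℂ V (t * s) = ρ.character (swap a b * swap a c) := by
      rw [LinearMap.trace_mul_comm, e2]
    have e4 : LinearMap.trace ℂ V s = ρ.character (swap a b) := rfl
    have e5 : LinearMap.trace ℂ V t = ρ.character (swap a b) := hχ.symm
    rw [map_smul, hA]
    simp only [map_add, map_sub, e1, e2, e3, e4, e5, LinearMap.trace_one, smul_eq_mul]
    push_cast
    ring
  have := re_trace_nonneg_of_isIdempotentElem hidem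
  rw [htr, Complex.re_ofReal_mul, Complex.sub_re, Complex.add_re, Complex.natCast_re,
    Complex.re_ofReal_mul, Complex.re_ofReal_mul] at this
  linarith

omit [Fintype α] in
-- For commuting involutions s and t, (1 - s)(1 - t)/4 is the projection on the vectors negated by
-- both; its trace is nonnegative.
theorem character_swap_mul_swap_ge [FiniteDimensional ℂ V] {a b c d : α}
    (h : [a, b, c, d].Nodup) :
    2 * (ρ.character (swap a b)).re ≤
      Module.finrank ℂ V + (ρ.character (swap a b * swap c d)).re := by
  have hcomm := (disjoint_swap_swap h).commute
  have hχ : ρ.character (swap a b) = ρ.character (swap c d) := by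
    refine character_eq_of_isConj ρ (isConj_swap ?_ ?_) <;>
    · simp at h
      tauto
  set s := ρ (swap a b) with hs
  set t := ρ (swap c d) with ht
  have hss : s * s = 1 := by rw [hs, ← map_mul, swap_mul_self, map_one]
  have htt : t * t = 1 := by rw [ht, ← map_mul, swap_mul_self, map_one]
  have hst : s * t = t * s := by rw [hs, ht, ← map_mul, ← map_mul, hcomm.eq]
  have hidem : IsIdempotentElem ((1 / 4 : ℂ) • (1 - s - t + s * t)) := by
    change ((1 / 4 : ℂ) • (1 - s - t + s * t)) * ((1 / 4 : ℂ) • (1 - s - t + s * t)) = _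
    have : (1 - s - t + s * t) * (1 - s - t + s * t) = (4 : ℂ) • (1 - s - t + s * t) := by
      have e : (1 - s - t + s * t) * (1 - s - t + s * t) =
        1 - 2 * s - 2 * t + 2 * (s * t) + s * s + t * t + (s * t + t * s) - (s * s) * t -
          s * (t * t) - (s * t) * s - t * (s * t) + (s * t) * (s * t) := by noncomm_ring
      have e1 : (s * t) * s = t := by rw [hst, mul_assoc, hss, mul_one]
      have e2 : t * (s * t) = s := by rw [hst, ← mul_assoc, htt, one_mul]
      have e3 : (s * t) * (s * t) = 1 := by rw [← mul_assoc, e1, htt]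
      rw [e, e1, e2, e3, hss, htt, ← hst, mul_one, one_mul, two_mul, two_mul, two_mul]
      module
    rw [smul_mul_smul_comm, this, smul_smul]
    norm_num
  have htr : LinearMap.trace ℂ V ((1 / 4 : ℂ) • (1 - s - t + s * t)) = ((1 / 4 : ℝ) : ℂ) *
      (Module.finrank ℂ V + ρ.character (swap a b * swap c d) -
        ((2 : ℝ) : ℂ) * ρ.character (swap a b)) := by
    have e2 : LinearMap.trace ℂ V (s * t) = ρ.character (swap a b * swap c d) := by
      rw [hs, ht, ← map_mul]
      rfl
    have e4 : LinearMap.trace ℂ V s = ρ.character (swap a b) := rfl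
    have e5 : LinearMap.trace ℂ V t = ρ.character (swap a b) := hχ.symm
    rw [map_smul]
    simp only [map_add, map_sub, e2, e4, e5, LinearMap.trace_one, smul_eq_mul]
    push_cast
    ring
  have := re_trace_nonneg_of_isIdempotentElem hidem
  rw [htr, Complex.re_ofReal_mul, Complex.sub_re, Complex.add_re, Complex.natCast_re,
    Complex.re_ofReal_mul] at this
  linarith

end Representation

end SymmetricGroup

/-! ### Support of p₂, lower bounds for T_K, and the fourth-root radicand. -/

section SymmetricGroup

open Equiv Equiv.Perm

theorem mk_eq_transpositions_iff {n : ℕ} (hn : 2 ≤ n) (g : Perm (Fin n)) :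
    ConjClasses.mk g = transpositions n hn ↔ g.IsSwap := by
  have h01 : (⟨0, by omega⟩ : Fin n) ≠ ⟨1, by omega⟩ := by simp
  rw [transpositions, ConjClasses.mk_eq_mk_iff_isConj, isConj_iff_cycleType_eq,
    isSwap_iff_cycleType, isSwap_iff_cycleType.1 ⟨_, _, h01, rfl⟩]

theorem mk_swap_eq_transpositions {n : ℕ} (hn : 2 ≤ n) {a b : Fin n} (hab : a ≠ b) :
    ConjClasses.mk (swap a b) = transpositions n hn :=
  (mk_eq_transpositions_iff hn _).2 ⟨a, b, hab, rfl⟩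

theorem mem_twoStepFactors_transpositions {n : ℕ} (hn : 2 ≤ n) {g h : Perm (Fin n)} :
    h ∈ twoStepFactors (transpositions n hn) g ↔ h.IsSwap ∧ (g * h⁻¹).IsSwap := by
  simp [twoStepFactors, mk_eq_transpositions_iff]

theorem mul_swap_cases {α : Type*} [DecidableEq α] {a b c d : α} (hab : a ≠ b) (hcd : c ≠ d) :
    swap a b * swap c d = 1 ∨
    (∃ x y z : α, x ≠ y ∧ x ≠ z ∧ y ≠ z ∧ swap a b * swap c d = swap x y * swap x z) ∨
    [a, b, c, d].Nodup := by
  by_cases hac : a = c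
  · subst hac
    by_cases hbd : b = d
    · left; rw [hbd, swap_mul_self]
    · right; left; exact ⟨a, b, d, hab, hcd, hbd, rfl⟩
  by_cases had : a = d
  · subst had
    by_cases hbc : b = c
    · left; rw [hbc, swap_comm, swap_mul_self]
    · right; left; exact ⟨a, b, c, hab, hac, hbc, by rw [swap_comm c a]⟩
  by_cases hbc : b = c
  · subst hbc
    right; left; exact ⟨b, a, d, hab.symm, hcd, had, by rw [swap_comm a b]⟩
  by_cases hbd : b = d
  · subst hbd
    right; left; exact ⟨b, a, c, hab.symm, hbc, hac, by rw [swap_comm a b, swap_comm c b]⟩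
  right; right
  simp [hab, hac, had, hbc, hbd, hcd]

theorem p₂_support {n : ℕ} (hn : 2 ≤ n) {K : ConjClasses (Perm (Fin n))}
    (h : p₂ (transpositions n hn) K ≠ 0) (hK : K ≠ ConjClasses.mk 1) :
    (∃ a b c : Fin n, a ≠ b ∧ a ≠ c ∧ b ≠ c ∧ K = ConjClasses.mk (swap a b * swap a c)) ∨
    (∃ a b c d : Fin n, [a, b, c, d].Nodup ∧ K = ConjClasses.mk (swap a b * swap c d)) := by
  obtain ⟨g, rfl, f, hf⟩ := exists_mem_twoStepFactors_of_p₂_ne_zero h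
  rw [mem_twoStepFactors_transpositions] at hf
  obtain ⟨⟨c, d, hcd, hf⟩, a, b, hab, hg⟩ := hf
  have hg' : g = swap a b * swap c d := by rw [← hg, ← hf, inv_mul_cancel_right]
  rcases mul_swap_cases hab hcd with h1 | ⟨x, y, z, hxy, hxz, hyz, h1⟩ | h1
  · exact absurd (by rw [hg', h1]) hK
  · exact .inl ⟨x, y, z, hxy, hxz, hyz, by rw [hg', h1]⟩
  · exact .inr ⟨a, b, c, d, h1, by rw [hg']⟩

/-- Both letters of a factor lie in the support of g: if (a b)(x y) fixed x, the two transpositions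
would coincide and g would be 1. This leaves at most 6 ordered pairs; the cruder 8 is what
`sum_fourth_moment_nonneg` can afford. -/
theorem card_twoStepFactors_of_isThreeCycle {n : ℕ} (hn : 2 ≤ n) {g : Perm (Fin n)}
    (hg : g.IsThreeCycle) : (twoStepFactors (transpositions n hn) g).card ≤ 8 := by
  have hsub : twoStepFactors (transpositions n hn) g ⊆
      g.support.offDiag.image fun p => swap p.1 p.2 := by
    intro h hh
    rw [mem_twoStepFactors_transpositions] at hh
    obtain ⟨⟨x, y, hxy, hf⟩, a, b, hab, hgh⟩ := hh
    have hg' : g = swap a b * swap x y := by rw [← hgh, hf, inv_mul_cancel_right]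
    have hne : g ≠ 1 := by
      rintro rfl
      exact absurd hg.card_support (by simp)
    have key : ∀ x y : Fin n, x ≠ y → g = swap a b * swap x y → x ∈ g.support := by
      intro x y hxy hg'
      rw [mem_support]
      intro hx
      rw [hg', mul_apply, swap_apply_left] at hx
      have hsw : swap a b = swap x y := by
        rcases eq_or_ne y a with rfl | hya
        · rw [swap_apply_left] at hx
          rw [hx, swap_comm]
        · rcases eq_or_ne y b with rfl | hyb
          · rw [swap_apply_right] at hx
            rw [hx]
          · rw [swap_apply_of_ne_of_ne hya hyb] at hx
            exact absurd hx hxy.symm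
      exact hne (by rw [hg', hsw, swap_mul_self])
    rw [Finset.mem_image]
    refine ⟨(x, y), ?_, hf.symm⟩
    rw [Finset.mem_offDiag]
    exact ⟨key x y hxy hg', key y x hxy.symm (by rw [hg', swap_comm x y]), hxy⟩
  refine (Finset.card_le_card hsub).trans (Finset.card_image_le.trans ?_)
  rw [Finset.offDiag_card, hg.card_support]
  norm_num

/-- By cycle type the two factors must be disjoint, so the product sends x to y for a factor (x y),
which is therefore one of its two cycles. -/
theorem card_twoStepFactors_of_cycleType {n : ℕ} (hn : 2 ≤ n) {a b c d : Fin n}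
    (h : [a, b, c, d].Nodup) :
    (twoStepFactors (transpositions n hn) (swap a b * swap c d)).card ≤ 2 := by
  have hsub : twoStepFactors (transpositions n hn) (swap a b * swap c d) ⊆
      {swap a b, swap c d} := by
    intro f hf
    rw [mem_twoStepFactors_transpositions] at hf
    obtain ⟨⟨x, y, hxy, rfl⟩, u, v, huv, hgh⟩ := hf
    have hg' : swap a b * swap c d = swap u v * swap x y := by
      rw [← hgh, inv_mul_cancel_right]
    have hct := cycleType_swap_mul_swap_of_nodup h
    have hd : [u, v, x, y].Nodup := by
      rcases mul_swap_cases huv hxy with h1 | ⟨p, q, r, h2, h3, h4, h1⟩ | h1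
      · rw [hg', h1] at hct
        simp at hct
      · rw [hg', h1, (isThreeCycle_swap_mul_swap_same h2 h3 h4).cycleType] at hct
        simp at hct
      · exact h1
    have hx : (swap a b * swap c d) x = y := by
      rw [hg', mul_apply, swap_apply_left, swap_apply_of_ne_of_ne] <;>
      · simp at hd
        tauto
    simp only [List.nodup_cons, List.mem_cons, not_or, List.not_mem_nil] at h
    obtain ⟨⟨hab, hac, had, -⟩, ⟨hbc, hbd, -⟩, ⟨hcd, -⟩, -⟩ := h
    rw [Finset.mem_insert, Finset.mem_singleton]
    subst hx
    rw [mul_apply] at hxy ⊢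
    rcases eq_or_ne x a with rfl | hxa
    · left; rw [swap_apply_of_ne_of_ne hac had, swap_apply_left]
    rcases eq_or_ne x b with rfl | hxb
    · left; rw [swap_apply_of_ne_of_ne hbc hbd, swap_apply_right, swap_comm]
    rcases eq_or_ne x c with rfl | hxc
    · right; rw [swap_apply_left, swap_apply_of_ne_of_ne (Ne.symm had) (Ne.symm hbd)]
    rcases eq_or_ne x d with rfl | hxd
    · right; rw [swap_apply_right, swap_apply_of_ne_of_ne (Ne.symm hac) (Ne.symm hbc), swap_comm]
    · rw [swap_apply_of_ne_of_ne hxc hxd, swap_apply_of_ne_of_ne hxa hxb] at hxy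
      exact absurd rfl hxy
  exact (Finset.card_le_card hsub).trans Finset.card_le_two

section Bounds

variable {n : ℕ} (hn : 2 ≤ n) {V : Type*} [AddCommGroup V] [Module ℂ V]
  (ρ : Representation ℂ (Perm (Fin n)) V)

theorem charRatio_transpositions {a b : Fin n} (hab : a ≠ b) :
    charRatio ρ (transpositions n hn) =
      (ρ.character (swap a b)).re / (Module.finrank ℂ V : ℝ) := by
  rw [← mk_swap_eq_transpositions hn hab, charRatio_mk]

variable {ρ} [FiniteDimensional ℂ V]

theorem finrank_pos_of_not_isTrivial (hρ : ¬ ρ.IsTrivial) : 0 < Module.finrank ℂ V := by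
  rw [Module.finrank_pos_iff]
  by_contra h
  rw [not_nontrivial_iff_subsingleton] at h
  exact hρ ⟨fun g => LinearMap.ext fun v => Subsingleton.elim _ _⟩

theorem aCoeff_transpositions_pos (hρ : ¬ ρ.IsTrivial) : 0 < aCoeff (transpositions n hn) ρ := by
  have h01 : (⟨0, by omega⟩ : Fin n) ≠ ⟨1, by omega⟩ := by simp
  have hd : (0 : ℝ) < Module.finrank ℂ V := by exact_mod_cast finrank_pos_of_not_isTrivial hρ
  rw [aCoeff, charRatio_transpositions hn ρ h01, sub_pos, div_lt_one hd]
  exact character_swap_lt_finrank ρ h01 hρ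

theorem tTerm_threeCycle_ge (hρ : ¬ ρ.IsTrivial) {a b c : Fin n} (hab : a ≠ b) (hac : a ≠ c)
    (hbc : b ≠ c) :
    -3 / 2 ≤ tTerm (transpositions n hn) ρ (ConjClasses.mk (swap a b * swap a c)) := by
  have hd : (0 : ℝ) < Module.finrank ℂ V := by exact_mod_cast finrank_pos_of_not_isTrivial hρ
  rw [tTerm, le_div_iff₀ (aCoeff_transpositions_pos hn hρ), aCoeff,
    charRatio_transpositions hn ρ hab, charRatio_mk, ← sub_nonneg]
  have := character_swap_mul_swap_same_ge ρ hab hac hbc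
  have e : (ρ.character (swap a b * swap a c)).re / (Module.finrank ℂ V : ℝ) - 1 -
      -3 / 2 * (1 - (ρ.character (swap a b)).re / (Module.finrank ℂ V : ℝ)) =
      (Module.finrank ℂ V + 2 * (ρ.character (swap a b * swap a c)).re -
        3 * (ρ.character (swap a b)).re) / (2 * (Module.finrank ℂ V : ℝ)) := by
    field_simp
    ring
  rw [e]
  exact div_nonneg (by linarith) (by linarith)

theorem tTerm_doubleSwap_ge (hρ : ¬ ρ.IsTrivial) {a b c d : Fin n} (h : [a, b, c, d].Nodup) :
    -2 ≤ tTerm (transpositions n hn) ρ (ConjClasses.mk (swap a b * swap c d)) := by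
  have hd : (0 : ℝ) < Module.finrank ℂ V := by exact_mod_cast finrank_pos_of_not_isTrivial hρ
  have hab : a ≠ b := by
    rintro rfl
    simp at h
  rw [tTerm, le_div_iff₀ (aCoeff_transpositions_pos hn hρ), aCoeff,
    charRatio_transpositions hn ρ hab, charRatio_mk, ← sub_nonneg]
  have := character_swap_mul_swap_ge ρ h
  have e : (ρ.character (swap a b * swap c d)).re / (Module.finrank ℂ V : ℝ) - 1 -
      -2 * (1 - (ρ.character (swap a b)).re / (Module.finrank ℂ V : ℝ)) =
      (Module.finrank ℂ V + (ρ.character (swap a b * swap c d)).re -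
        2 * (ρ.character (swap a b)).re) / (Module.finrank ℂ V : ℝ) := by
    field_simp
    ring
  rw [e]
  exact div_nonneg (by linarith) (by linarith)

/-- The expression under the fourth root is nonnegative. -/
theorem sum_fourth_moment_nonneg (hρ : ¬ ρ.IsTrivial) :
    0 ≤ ∑ K, p₂ (transpositions n hn) K ^ 2 / classSize K *
      (8 + 6 * tTerm (transpositions n hn) ρ K) := by
  set C := transpositions n hn with hC
  have hN := classSize_pos C
  have hV : Nontrivial V := Module.finrank_pos_iff.1 (finrank_pos_of_not_isTrivial hρ)
  have hone : p₂ C (ConjClasses.mk 1) = 1 / classSize C := by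
    refine p₂_mk_one C fun g hg => ?_
    rw [hC, mk_eq_transpositions_iff] at hg ⊢
    obtain ⟨a, b, hab, rfl⟩ := hg
    exact ⟨a, b, hab, swap_inv a b⟩
  -- The identity contributes 8/|C|², which has to absorb all negative terms. At 3-cycles 8 + 6T ≥
  -- -1 with at most 8 factorizations, at double transpositions 8 + 6T ≥ -4 with at most 2; either
  -- way the loss is at most 8 p₂(K)/|C|², and the p₂(K) sum to at most 1.
  have key : ∀ K, K ≠ ConjClasses.mk 1 → -(8 / classSize C ^ 2) * p₂ C K ≤
      p₂ C K ^ 2 / classSize K * (8 + 6 * tTerm C ρ K) := by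
    intro K hK
    by_cases hp : p₂ C K = 0
    · simp [hp]
    have hp0 : 0 ≤ p₂ C K ^ 2 / classSize K := div_nonneg (sq_nonneg _) (classSize_pos K).le
    rcases p₂_support hn hp hK with ⟨a, b, c, hab, hac, hbc, rfl⟩ | ⟨a, b, c, d, h, rfl⟩
    · have ht := tTerm_threeCycle_ge hn hρ hab hac hbc
      have hle := p₂_sq_div_le (C := C) (K := ConjClasses.mk (swap a b * swap a c)) (b := 8) (by
        intro g hg
        refine card_twoStepFactors_of_isThreeCycle hn ?_
        rw [ConjClasses.mk_eq_mk_iff_isConj, isConj_iff_cycleType_eq] at hg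
        exact hg.trans (isThreeCycle_swap_mul_swap_same hab hac hbc))
      push_cast at hle
      nlinarith
    · have ht := tTerm_doubleSwap_ge hn hρ h
      have hle := p₂_sq_div_le (C := C) (K := ConjClasses.mk (swap a b * swap c d)) (b := 2) (by
        intro g hg
        rw [ConjClasses.mk_eq_mk_iff_isConj] at hg
        obtain ⟨σ, rfl⟩ := isConj_iff.1 hg.symm
        have e : σ * (swap a b * swap c d) * σ⁻¹ = swap (σ a) (σ b) * swap (σ c) (σ d) := by
          rw [swap_apply_apply, swap_apply_apply]
          group
        rw [e]
        refine card_twoStepFactors_of_cycleType hn ?_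
        exact h.map σ.injective)
      push_cast at hle
      have e : 8 / classSize C ^ 2 = 4 * (2 / classSize C ^ 2) := by ring
      rw [e]
      nlinarith
  rw [← Finset.add_sum_erase _ _ (Finset.mem_univ (ConjClasses.mk 1)), hone, tTerm_mk_one,
    classSize_mk_one]
  have hsum : ∑ K ∈ Finset.univ.erase (ConjClasses.mk 1), -(8 / classSize C ^ 2) * p₂ C K ≤
      ∑ K ∈ Finset.univ.erase (ConjClasses.mk 1),
        p₂ C K ^ 2 / classSize K * (8 + 6 * tTerm C ρ K) :=
    Finset.sum_le_sum fun K hK => key K (Finset.ne_of_mem_erase hK)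
  rw [← Finset.mul_sum] at hsum
  have hle : ∑ K ∈ Finset.univ.erase (ConjClasses.mk 1), p₂ C K ≤ 1 := by
    rw [← sum_p₂ C]
    exact Finset.sum_le_sum_of_subset_of_nonneg (Finset.erase_subset _ _)
      fun K _ _ => p₂_nonneg C K
  have h8 : 0 ≤ 8 / classSize C ^ 2 := by positivity
  have : (1 / classSize C) ^ 2 / 1 * (8 + 6 * 0) = 8 / classSize C ^ 2 := by ring
  rw [this]
  nlinarith

/-- Comparison of the error terms of two representations of the symmetric group from the values at
the `3`-cycles and at the products of two disjoint transpositions. -/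
theorem errorTerm_transpositions_le {W : Type*} [AddCommGroup W] [Module ℂ W]
    [FiniteDimensional ℂ W] {ρ' : Representation ℂ (Perm (Fin n)) W} (hρ : ¬ ρ.IsTrivial)
    (hρ' : ¬ ρ'.IsTrivial)
    (h3 : ∀ a b c : Fin n, a ≠ b → a ≠ c → b ≠ c →
      tTerm (transpositions n hn) ρ (ConjClasses.mk (swap a b * swap a c)) ≤
        tTerm (transpositions n hn) ρ' (ConjClasses.mk (swap a b * swap a c)))
    (h4 : ∀ a b c d : Fin n, [a, b, c, d].Nodup →
      tTerm (transpositions n hn) ρ (ConjClasses.mk (swap a b * swap c d)) ≤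
        tTerm (transpositions n hn) ρ' (ConjClasses.mk (swap a b * swap c d))) :
    errorTerm (transpositions n hn) ρ ≤ errorTerm (transpositions n hn) ρ' := by
  have hV : Nontrivial V := Module.finrank_pos_iff.1 (finrank_pos_of_not_isTrivial hρ)
  have hW : Nontrivial W := Module.finrank_pos_iff.1 (finrank_pos_of_not_isTrivial hρ')
  refine errorTerm_le_errorTerm _ ρ ρ' (sum_fourth_moment_nonneg hn hρ) fun K hK hp => ?_
  rcases p₂_support hn hp hK with ⟨a, b, c, hab, hac, hbc, rfl⟩ | ⟨a, b, c, d, h, rfl⟩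
  · exact ⟨by linarith [tTerm_threeCycle_ge hn hρ hab hac hbc], h3 a b c hab hac hbc⟩
  · exact ⟨tTerm_doubleSwap_ge hn hρ h, h4 a b c d h⟩

end Bounds

end SymmetricGroup

/-! ### Column antisymmetrizers applied to moved tabloids. -/

section SpechtScalars

open Equiv Equiv.Perm

variable {n : ℕ} {lam : YoungDiagram} (T : Tableau n lam)

/-- The column antisymmetrizer of a tableau, as an operator on the space of row assignments. -/
def colAntisymmetrizer : Module.End ℂ ((Fin n → ℕ) →₀ ℂ) :=
  ∑ σ ∈ colStabilizer T, ((sign σ : ℤ) : ℂ) • entryRep n σ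

theorem entryRep_single (σ : Perm (Fin n)) (f : Fin n → ℕ) :
    entryRep n σ (Finsupp.single f 1) = Finsupp.single (f ∘ (σ⁻¹ : Perm (Fin n))) 1 := by
  change Finsupp.mapDomain _ (Finsupp.single f (1 : ℂ)) = _
  rw [Finsupp.mapDomain_single]

theorem colAntisymmetrizer_tabloid :
    colAntisymmetrizer T (Finsupp.single (tabloid T) 1) = polytabloid T := by
  simp only [colAntisymmetrizer, polytabloid, LinearMap.sum_apply, LinearMap.smul_apply]

/-- The image of a row assignment under the column antisymmetrizer. -/
def antisymm (f : Fin n → ℕ) : (Fin n → ℕ) →₀ ℂ :=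
  colAntisymmetrizer T (Finsupp.single f 1)

theorem colAntisymmetrizer_mul_swap {a b : Fin n} (hab : a ≠ b)
    (hcol : (T a).1.2 = (T b).1.2) :
    colAntisymmetrizer T * entryRep n (swap a b) = -colAntisymmetrizer T := by
  unfold colAntisymmetrizer
  rw [Finset.sum_mul]
  refine Eq.trans ?_ (Finset.sum_neg_distrib fun σ => ((sign σ : ℤ) : ℂ) • entryRep n σ)
  refine Finset.sum_bij' (fun σ _ => σ * swap a b) (fun σ _ => σ * swap a b) ?_ ?_ ?_ ?_ ?_
  iterate 2
    intro σ hσ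
    simp only [colStabilizer, Finset.mem_filter, Finset.mem_univ, true_and] at hσ ⊢
    intro i
    rw [mul_apply, hσ]
    rcases eq_or_ne i a with rfl | hia
    · rw [swap_apply_left, hcol]
    rcases eq_or_ne i b with rfl | hib
    · rw [swap_apply_right, hcol]
    · rw [swap_apply_of_ne_of_ne hia hib]
  · intro σ _; rw [mul_assoc, swap_mul_self, mul_one]
  · intro σ _; rw [mul_assoc, swap_mul_self, mul_one]
  · intro σ _
    rw [smul_mul_assoc, ← map_mul, Perm.sign_mul, sign_swap hab]
    simp only [mul_neg, mul_one, Units.val_neg, Int.cast_neg]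
    exact LinearMap.ext fun v => by
      rw [LinearMap.neg_apply, LinearMap.smul_apply, LinearMap.smul_apply, neg_smul, neg_neg]

theorem antisymm_comp_swap {a b : Fin n} (hab : a ≠ b) (hcol : (T a).1.2 = (T b).1.2)
    (f : Fin n → ℕ) : antisymm T (f ∘ swap a b) = -antisymm T f := by
  have h := LinearMap.congr_fun (colAntisymmetrizer_mul_swap T hab hcol) (Finsupp.single f 1)
  rw [Module.End.mul_apply, entryRep_single, swap_inv] at h
  exact h

/-- The transposition of a and b fixes f, but changes the sign of its antisymmetrization. -/
theorem antisymm_eq_zero {a b : Fin n} (hab : a ≠ b) (hcol : (T a).1.2 = (T b).1.2)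
    {f : Fin n → ℕ} (hf : f a = f b) : antisymm T f = 0 := by
  have h := antisymm_comp_swap T hab hcol f
  have : f ∘ swap a b = f := by
    funext i
    rw [Function.comp_apply, swap_apply_def]
    split_ifs with h1 h2
    · rw [h1, hf]
    · rw [h2, hf]
    · rfl
  rw [this] at h
  exact self_eq_neg.1 h

theorem exists_entry_above {b : Fin n} {i : ℕ} (hi : i < (T b).1.1) :
    ∃ x, x ≠ b ∧ (T x).1.1 = i ∧ (T x).1.2 = (T b).1.2 := by
  have hmem : (i, (T b).1.2) ∈ lam.cells :=
    lam.isLowerSet (show (i, (T b).1.2) ≤ (T b).1 from ⟨hi.le, le_rfl⟩) (T b).2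
  refine ⟨T.symm ⟨_, hmem⟩, ?_, by simp, by simp⟩
  rintro h
  rw [← h] at hi
  simp at hi

/-- A swap within a row fixes the tabloid, one within a column produces a sign. Otherwise the lower
entry is lifted into the row of the higher one, where it meets the entry above it in its own column,
and `antisymm_eq_zero` applies. -/
theorem antisymm_swap {a b : Fin n} (hab : a ≠ b) :
    antisymm T (tabloid T ∘ swap a b) =
      (((if (T a).1.1 = (T b).1.1 then 1 else 0) - (if (T a).1.2 = (T b).1.2 then 1 else 0) : ℤ) :
        ℂ) • polytabloid T := by
  have hne : ¬ ((T a).1.1 = (T b).1.1 ∧ (T a).1.2 = (T b).1.2) := fun h =>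
    hab (T.injective (Subtype.ext (Prod.ext h.1 h.2)))
  by_cases hrow : (T a).1.1 = (T b).1.1
  · rw [if_pos hrow, if_neg fun h => hne ⟨hrow, h⟩]
    have : tabloid T ∘ swap a b = tabloid T := by
      funext i
      rw [Function.comp_apply, swap_apply_def]
      split_ifs with h1 h2
      · rw [h1]; exact hrow.symm
      · rw [h2]; exact hrow
      · rfl
    rw [this, antisymm, colAntisymmetrizer_tabloid]
    simp
  by_cases hcol : (T a).1.2 = (T b).1.2
  · rw [if_pos hcol, if_neg hrow, antisymm_comp_swap T hab hcol, antisymm,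
      colAntisymmetrizer_tabloid]
    simp
  rw [if_neg hrow, if_neg hcol]
  have key : ∀ a b : Fin n, a ≠ b → (T a).1.1 < (T b).1.1 → (T a).1.2 ≠ (T b).1.2 →
      antisymm T (tabloid T ∘ swap a b) = 0 := by
    intro a b hab hlt hcol
    obtain ⟨x, hxb, hx1, hx2⟩ := exists_entry_above T hlt
    have hxa : x ≠ a := by
      rintro rfl
      exact hcol hx2
    refine antisymm_eq_zero T hxb hx2 ?_
    rw [Function.comp_apply, Function.comp_apply, swap_apply_right, swap_apply_of_ne_of_ne hxa hxb]
    exact hx1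
  rcases lt_or_gt_of_ne hrow with h | h
  · rw [key a b hab h hcol]; simp
  · rw [swap_comm, key b a hab.symm h (Ne.symm hcol)]; simp

/-- Indicator that two distinct entries are in the same row. -/
def sameRow (a b : Fin n) : ℤ := if a ≠ b ∧ (T a).1.1 = (T b).1.1 then 1 else 0

/-- Indicator that two distinct entries are in the same column. -/
def sameCol (a b : Fin n) : ℤ := if a ≠ b ∧ (T a).1.2 = (T b).1.2 then 1 else 0

theorem antisymm_swap' {a b : Fin n} (hab : a ≠ b) :
    antisymm T (tabloid T ∘ swap a b) =
      ((sameRow T a b - sameCol T a b : ℤ) : ℂ) • polytabloid T := by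
  rw [antisymm_swap T hab]
  simp [sameRow, sameCol, hab]

/-- The scalar by which the antisymmetrized `3`-cycle on three entries acts. -/
def threeCycleCoeff (a b c : Fin n) : ℤ :=
  sameRow T a b * sameRow T b c + sameCol T a b * sameCol T b c
    - (sameRow T b c * sameCol T c a + sameRow T c a * sameCol T a b
      + sameRow T a b * sameCol T b c)

theorem sameRow_comm (a b : Fin n) : sameRow T a b = sameRow T b a := by
  unfold sameRow
  grind

theorem sameCol_comm (a b : Fin n) : sameCol T a b = sameCol T b a := by
  unfold sameCol
  grind

theorem sameRow_mul_sameCol (a b : Fin n) : sameRow T a b * sameCol T a b = 0 := by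
  unfold sameRow sameCol
  split_ifs with h1 h2
  · exact absurd (T.injective (Subtype.ext (Prod.ext h1.2 h2.2))) h1.1
  all_goals rfl

theorem sameRow_mul_sameRow {a b c : Fin n} (hab : a ≠ b) (hac : a ≠ c) (hbc : b ≠ c) :
    sameRow T a b * sameRow T b c = sameRow T b c * sameRow T c a := by
  unfold sameRow
  grind

theorem sameCol_mul_sameCol {a b c : Fin n} (hab : a ≠ b) (hac : a ≠ c) (hbc : b ≠ c) :
    sameCol T a b * sameCol T b c = sameCol T b c * sameCol T c a := by
  unfold sameCol
  grind

theorem threeCycleCoeff_rotate {a b c : Fin n} (hab : a ≠ b) (hac : a ≠ c) (hbc : b ≠ c) :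
    threeCycleCoeff T a b c = threeCycleCoeff T b c a := by
  unfold threeCycleCoeff
  rw [sameRow_mul_sameRow T hab hac hbc, sameCol_mul_sameCol T hab hac hbc]
  ring

theorem threeCycleCoeff_of_row_eq {a b c : Fin n} (hab : a ≠ b) (hac : a ≠ c) (hbc : b ≠ c)
    (h : (T b).1.1 = (T c).1.1) :
    threeCycleCoeff T a b c = sameRow T a c - sameCol T a c := by
  have h1 : sameRow T b c = 1 := by simp [sameRow, hbc, h]
  have h2 := sameRow_mul_sameCol T b c
  have h3 : sameRow T a c = sameRow T a b := by simp [sameRow, hab, hac, h]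
  have h4 := sameRow_mul_sameCol T a b
  unfold threeCycleCoeff
  rw [sameRow_comm T c a, sameCol_comm T c a, h3, h1, h4]
  rw [h1, one_mul] at h2
  rw [h2]
  ring

theorem threeCycleCoeff_of_col_eq {a b c : Fin n} (hab : a ≠ b) (hac : a ≠ c) (hbc : b ≠ c)
    (h : (T b).1.2 = (T c).1.2) :
    threeCycleCoeff T a b c = -(sameRow T a b - sameCol T a b) := by
  have h1 : sameCol T b c = 1 := by simp [sameCol, hbc, h]
  have h2 := sameRow_mul_sameCol T b c
  have h3 : sameCol T a b = sameCol T a c := by simp [sameCol, hab, hac, h]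
  have h4 := sameRow_mul_sameCol T a c
  unfold threeCycleCoeff
  rw [sameRow_comm T c a, sameCol_comm T c a, h3, h1, h4]
  rw [h1, mul_one] at h2
  rw [h2]
  ring

/-- If two of the entries share a row or a column, the 3-cycle acts on the tabloid like a single
transposition, up to sign. If none do, some entry is lifted to a higher row and collides there with
an entry of its own column, giving zero. Rotating the cycle reduces every case to one position of
the pair. -/
theorem antisymm_threeCycle {a b c : Fin n} (hab : a ≠ b) (hac : a ≠ c) (hbc : b ≠ c) :
    antisymm T (tabloid T ∘ ((swap a b * swap a c)⁻¹ : Perm (Fin n))) =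
      ((threeCycleCoeff T a b c : ℤ) : ℂ) • polytabloid T := by
  have hcyc : ∀ a b c : Fin n, a ≠ b → a ≠ c → b ≠ c →
      swap a b * swap a c = swap b c * swap b a := by
    intro a b c hab hac hbc
    ext x
    simp only [mul_apply, swap_apply_def]
    congr 1
    grind
  have hval : ∀ a b c : Fin n, a ≠ b → a ≠ c → b ≠ c →
      let f := tabloid T ∘ ((swap a b * swap a c)⁻¹ : Perm (Fin n))
      f a = (T b).1.1 ∧ f b = (T c).1.1 ∧ f c = (T a).1.1 ∧
        ∀ x, x ≠ a → x ≠ b → x ≠ c → f x = (T x).1.1 := by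
    intro a b c hab hac hbc
    simp only [mul_inv_rev, swap_inv, Function.comp_apply, mul_apply, swap_apply_def, tabloid]
    grind
  have hrow : ∀ a b c : Fin n, a ≠ b → a ≠ c → b ≠ c → (T b).1.1 = (T c).1.1 →
      antisymm T (tabloid T ∘ ((swap a b * swap a c)⁻¹ : Perm (Fin n))) =
      ((threeCycleCoeff T a b c : ℤ) : ℂ) • polytabloid T := by
    intro a b c hab hac hbc h
    obtain ⟨h1, h2, h3, h4⟩ := hval a b c hab hac hbc
    have : tabloid T ∘ ((swap a b * swap a c)⁻¹ : Perm (Fin n)) = tabloid T ∘ swap a c := by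
      funext x
      rw [Function.comp_apply (f := tabloid T) (g := swap a c), swap_apply_def, tabloid]
      grind
    rw [this, antisymm_swap' T hac, threeCycleCoeff_of_row_eq T hab hac hbc h]
  have hcol : ∀ a b c : Fin n, a ≠ b → a ≠ c → b ≠ c → (T b).1.2 = (T c).1.2 →
      antisymm T (tabloid T ∘ ((swap a b * swap a c)⁻¹ : Perm (Fin n))) =
      ((threeCycleCoeff T a b c : ℤ) : ℂ) • polytabloid T := by
    intro a b c hab hac hbc h
    have hperm : ((swap a b * swap a c)⁻¹ : Perm (Fin n)) = swap a b * swap b c := by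
      rw [mul_inv_rev, swap_inv, swap_inv]
      ext x
      simp only [mul_apply, swap_apply_def]
      congr 1
      grind
    have : tabloid T ∘ ((swap a b * swap a c)⁻¹ : Perm (Fin n)) =
        (tabloid T ∘ swap a b) ∘ swap b c := by
      rw [hperm]
      rfl
    rw [this, antisymm_comp_swap T hbc h, antisymm_swap' T hab, ← neg_smul, ← Int.cast_neg,
      threeCycleCoeff_of_col_eq T hab hac hbc h]
  have hup : ∀ a b c : Fin n, a ≠ b → a ≠ c → b ≠ c → (T c).1.1 < (T b).1.1 →
      (T b).1.2 ≠ (T c).1.2 → (T a).1.2 ≠ (T b).1.2 →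
      antisymm T (tabloid T ∘ ((swap a b * swap a c)⁻¹ : Perm (Fin n))) = 0 := by
    intro a b c hab hac hbc hlt hcb hca
    obtain ⟨h1, h2, h3, h4⟩ := hval a b c hab hac hbc
    obtain ⟨x, hxb, hx1, hx2⟩ := exists_entry_above T hlt
    refine antisymm_eq_zero T hxb hx2 ?_
    rw [h2, h4, hx1]
    · rintro rfl; exact hca hx2
    · exact hxb
    · rintro rfl; exact hcb hx2.symm
  have cyc1 := hcyc a b c hab hac hbc
  have cyc2 := hcyc b c a hbc hab.symm hac.symm
  have co1 := threeCycleCoeff_rotate T hab hac hbc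
  have co2 := threeCycleCoeff_rotate T hbc hab.symm hac.symm
  by_cases r1 : (T b).1.1 = (T c).1.1
  · exact hrow a b c hab hac hbc r1
  by_cases r2 : (T c).1.1 = (T a).1.1
  · rw [cyc1, co1]
    exact hrow b c a hbc hab.symm hac.symm r2
  by_cases r3 : (T a).1.1 = (T b).1.1
  · rw [cyc1, co1, cyc2, co2]
    exact hrow c a b hac.symm hbc.symm hab r3
  by_cases c1 : (T b).1.2 = (T c).1.2
  · exact hcol a b c hab hac hbc c1
  by_cases c2 : (T c).1.2 = (T a).1.2
  · rw [cyc1, co1]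
    exact hcol b c a hbc hab.symm hac.symm c2
  by_cases c3 : (T a).1.2 = (T b).1.2
  · rw [cyc1, co1, cyc2, co2]
    exact hcol c a b hac.symm hbc.symm hab c3
  have hz : threeCycleCoeff T a b c = 0 := by
    unfold threeCycleCoeff sameRow sameCol
    simp [r1, r2, r3, c1, c2, c3]
  rw [hz, Int.cast_zero, zero_smul]
  rcases lt_or_gt_of_ne r1 with h1 | h1
  · rcases lt_or_gt_of_ne r2 with h2 | h2
    · rw [cyc1, cyc2]
      exact hup c a b hac.symm hbc.symm hab (h1.trans h2) c3 c2
    · rw [cyc1]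
      exact hup b c a hbc hab.symm hac.symm h2 c2 c1
  · exact hup a b c hab hac hbc h1 c1 c3

end SpechtScalars

/-! ### Class sums act by scalars on Specht modules. -/

section ScalarSums

open Equiv Equiv.Perm

variable {n : ℕ} {lam : YoungDiagram}

/-- Conjugation invariance makes the sum Z central, so Z e_T = Z κ_T {T} = κ_T Z {T} for the column
antisymmetrizer κ_T. It suffices to antisymmetrize the moved tabloids; no irreducibility is used. -/
theorem sum_spechtRep_eq_smul {ι : Type*} [Fintype ι] (w : ι → ℤ) (g : ι → Perm (Fin n)) (c : ℤ)
    (hg : ∀ σ : Perm (Fin n), ∃ e : Perm ι, ∀ i, w (e i) = w i ∧ g (e i) = σ * g i * σ⁻¹)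
    (hT : ∀ T : Tableau n lam, ∑ i, (w i : ℂ) • antisymm T (tabloid T ∘ ((g i)⁻¹ : Perm (Fin n))) =
      (c : ℂ) • polytabloid T) :
    ∑ i, (w i : ℂ) • spechtRep n lam (g i) = (c : ℂ) • 1 := by
  set Z : Module.End ℂ ((Fin n → ℕ) →₀ ℂ) := ∑ i, (w i : ℂ) • entryRep n (g i) with hZ
  have hcomm : ∀ σ, Z * entryRep n σ = entryRep n σ * Z := by
    intro σ
    obtain ⟨e, he⟩ := hg σ
    rw [hZ, Finset.sum_mul, Finset.mul_sum, ← Equiv.sum_comp e]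
    refine Finset.sum_congr rfl fun i _ => ?_
    rw [(he i).1, (he i).2, smul_mul_assoc, mul_smul_comm, ← map_mul, ← map_mul,
      inv_mul_cancel_right]
  have hκ : ∀ T : Tableau n lam, Z * colAntisymmetrizer T = colAntisymmetrizer T * Z := by
    intro T
    unfold colAntisymmetrizer
    rw [Finset.mul_sum _ _ Z, Finset.sum_mul _ _ Z]
    refine Finset.sum_congr rfl fun σ _ => ?_
    rw [smul_mul_assoc, mul_smul_comm, hcomm]
  have hspan : ∀ v ∈ spechtModule n lam, Z v = (c : ℂ) • v := by
    intro v hv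
    refine Submodule.span_induction (p := fun v _ => Z v = (c : ℂ) • v) ?_ ?_ ?_ ?_ hv
    · rintro _ ⟨T, rfl⟩
      rw [← hT T]
      have := LinearMap.congr_fun (hκ T) (Finsupp.single (tabloid T) 1)
      rw [Module.End.mul_apply, Module.End.mul_apply, colAntisymmetrizer_tabloid] at this
      rw [this, hZ, LinearMap.sum_apply, map_sum]
      refine Finset.sum_congr rfl fun i _ => ?_
      rw [LinearMap.smul_apply, map_smul, entryRep_single]
      rfl
    · simp
    · intro x y _ _ hx hy
      rw [map_add, hx, hy, smul_add]
    · intro a x _ hx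
      rw [map_smul, hx, smul_comm]
  refine LinearMap.ext fun v => Subtype.ext ?_
  have := hspan v v.2
  rw [hZ, LinearMap.sum_apply] at this
  rw [LinearMap.sum_apply, AddSubmonoidClass.coe_finsetSum]
  exact this

section Trace

variable {G V ι : Type*} [Group G] [AddCommGroup V] [Module ℂ V] [FiniteDimensional ℂ V]
  [Fintype ι] {ρ : Representation ℂ G V} {w : ι → ℤ} {g : ι → G} {c : ℤ}

theorem sum_charRatio_eq [Nontrivial V] (h : ∑ i, (w i : ℂ) • ρ (g i) = (c : ℂ) • 1) :
    ∑ i, (w i : ℝ) * charRatio ρ (ConjClasses.mk (g i)) = c := by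
  have hd : (Module.finrank ℂ V : ℝ) ≠ 0 := by exact_mod_cast Module.finrank_pos.ne'
  have htr := congrArg (fun f => (LinearMap.trace ℂ V f).re) h
  simp only [map_sum, map_smul, LinearMap.trace_one, smul_eq_mul, Complex.re_sum] at htr
  have e : ∀ i, ((w i : ℂ) * LinearMap.trace ℂ V (ρ (g i))).re =
      (w i : ℝ) * (ρ.character (g i)).re := by
    intro i
    rw [← Complex.ofReal_intCast, Complex.re_ofReal_mul]
    rfl
  simp only [e] at htr
  rw [← Complex.ofReal_intCast, Complex.re_ofReal_mul, Complex.natCast_re] at htr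
  simp only [charRatio_mk, mul_div_assoc']
  rw [← Finset.sum_div, htr, mul_div_assoc, div_self hd, mul_one]

/-- The square of the scalar identity is again such an identity, indexed by pairs. It reaches double
transpositions without a separate tabloid computation. -/
theorem sum_sum_charRatio_eq [Nontrivial V] (h : ∑ i, (w i : ℂ) • ρ (g i) = (c : ℂ) • 1) :
    ∑ i, ∑ j, ((w i : ℝ) * w j) * charRatio ρ (ConjClasses.mk (g i * g j)) = (c : ℝ) ^ 2 := by
  have h2 : ∑ p : ι × ι, ((w p.1 * w p.2 : ℤ) : ℂ) • ρ (g p.1 * g p.2) = ((c ^ 2 : ℤ) : ℂ) • 1 := by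
    have := congrArg₂ (· * ·) h h
    simp only [Finset.sum_mul_sum] at this
    rw [Fintype.sum_prod_type]
    simp only [smul_mul_smul_comm, ← map_mul] at this
    push_cast
    rw [this, sq, mul_one]
  have := sum_charRatio_eq h2
  rw [Fintype.sum_prod_type] at this
  push_cast at this
  exact this

end Trace

theorem card_filter_row (T : Tableau n lam) (i : ℕ) :
    (Finset.univ.filter fun b => (T b).1.1 = i).card = lam.rowLen i := by
  rw [YoungDiagram.rowLen_eq_card]
  refine Finset.card_bij (fun b _ => (T b).1) ?_ ?_ ?_
  · intro b hb
    rw [YoungDiagram.mem_row_iff]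
    exact ⟨(T b).2, by simpa using hb⟩
  · intro b _ b' _ h
    exact T.injective (Subtype.ext h)
  · intro c hc
    rw [YoungDiagram.mem_row_iff] at hc
    exact ⟨T.symm ⟨c, hc.1⟩, by simp [hc.2], by simp⟩

theorem card_filter_col (T : Tableau n lam) (j : ℕ) :
    (Finset.univ.filter fun b => (T b).1.2 = j).card = lam.colLen j := by
  rw [YoungDiagram.colLen_eq_card]
  refine Finset.card_bij (fun b _ => (T b).1) ?_ ?_ ?_
  · intro b hb
    rw [YoungDiagram.mem_col_iff]
    exact ⟨(T b).2, by simpa using hb⟩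
  · intro b _ b' _ h
    exact T.injective (Subtype.ext h)
  · intro c hc
    rw [YoungDiagram.mem_col_iff] at hc
    exact ⟨T.symm ⟨c, hc.1⟩, by simp [hc.2], by simp⟩

theorem sum_sameRow (T : Tableau n lam) (a : Fin n) :
    ∑ b, sameRow T a b = (lam.rowLen (T a).1.1 : ℤ) - 1 := by
  have : ∀ b, sameRow T a b =
      (if (T b).1.1 = (T a).1.1 then 1 else 0) - (if b = a then 1 else 0) := by
    intro b
    unfold sameRow
    grind
  simp only [this, Finset.sum_sub_distrib, Finset.sum_boole, card_filter_row, Finset.filter_eq',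
    Finset.mem_univ, if_true, Finset.card_singleton, Nat.cast_one]

theorem sum_sameCol (T : Tableau n lam) (a : Fin n) :
    ∑ b, sameCol T a b = (lam.colLen (T a).1.2 : ℤ) - 1 := by
  have : ∀ b, sameCol T a b =
      (if (T b).1.2 = (T a).1.2 then 1 else 0) - (if b = a then 1 else 0) := by
    intro b
    unfold sameCol
    grind
  simp only [this, Finset.sum_sub_distrib, Finset.sum_boole, card_filter_col, Finset.filter_eq',
    Finset.mem_univ, if_true, Finset.card_singleton, Nat.cast_one]

/-- The scalar by which the sum of the transpositions `(a b)` over the ordered pairs of distinct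
entries acts. -/
def swapScalar (lam : YoungDiagram) : ℤ :=
  ∑ c ∈ lam.cells, ((lam.rowLen c.1 : ℤ) - lam.colLen c.2)

/-- The scalar by which the sum of the `3`-cycles over the ordered triples of distinct entries
acts. -/
def threeCycleScalar (lam : YoungDiagram) : ℤ :=
  ∑ c ∈ lam.cells, (((lam.rowLen c.1 : ℤ) - 1) * (lam.rowLen c.1 - 2) +
    ((lam.colLen c.2 : ℤ) - 1) * (lam.colLen c.2 - 2) -
      3 * (((lam.rowLen c.1 : ℤ) - 1) * (lam.colLen c.2 - 1)))

theorem sum_tableau (T : Tableau n lam) (f : ℕ × ℕ → ℤ) :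
    ∑ a, f (T a).1 = ∑ c ∈ lam.cells, f c := by
  rw [← Finset.sum_coe_sort lam.cells f]
  exact Equiv.sum_comp T fun c : lam.cells => f c

theorem sum_swap_spechtRep (n : ℕ) (lam : YoungDiagram) :
    ∑ p : Fin n × Fin n, ((if p.1 ≠ p.2 then 1 else 0 : ℤ) : ℂ) • spechtRep n lam (swap p.1 p.2) =
      (swapScalar lam : ℂ) • 1 := by
  refine sum_spechtRep_eq_smul (fun p : Fin n × Fin n => if p.1 ≠ p.2 then 1 else 0)
    (fun p => swap p.1 p.2) _ ?_ ?_
  · intro σ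
    refine ⟨Equiv.prodCongr σ σ, fun p => ⟨?_, ?_⟩⟩
    · simp
    · exact swap_apply_apply σ p.1 p.2
  · intro T
    have hterm : ∀ p : Fin n × Fin n, ((if p.1 ≠ p.2 then 1 else 0 : ℤ) : ℂ) •
        antisymm T (tabloid T ∘ ((swap p.1 p.2)⁻¹ : Perm (Fin n))) =
        ((sameRow T p.1 p.2 - sameCol T p.1 p.2 : ℤ) : ℂ) • polytabloid T := by
      intro p
      by_cases h : p.1 = p.2
      · simp [h, sameRow, sameCol]
      · rw [if_pos h, swap_inv, antisymm_swap' T h]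
        simp
    simp only [hterm]
    rw [← Finset.sum_smul, ← Int.cast_sum]
    congr 2
    rw [Fintype.sum_prod_type]
    rw [swapScalar, ← sum_tableau T fun c => (lam.rowLen c.1 : ℤ) - lam.colLen c.2]
    refine Finset.sum_congr rfl fun a _ => ?_
    rw [Finset.sum_sub_distrib, sum_sameRow, sum_sameCol]
    ring

theorem sameRow_self (T : Tableau n lam) (a : Fin n) : sameRow T a a = 0 := by
  simp [sameRow]

theorem sameCol_self (T : Tableau n lam) (a : Fin n) : sameCol T a a = 0 := by
  simp [sameCol]

theorem sameRow_mul_self (T : Tableau n lam) (a b : Fin n) :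
    sameRow T a b * sameRow T a b = sameRow T a b := by
  unfold sameRow
  split_ifs <;> rfl

theorem sameCol_mul_self (T : Tableau n lam) (a b : Fin n) :
    sameCol T a b * sameCol T a b = sameCol T a b := by
  unfold sameCol
  split_ifs <;> rfl

theorem sum_threeCycleCoeff (T : Tableau n lam) :
    ∑ a, ∑ b, ∑ c, (if a ≠ b ∧ a ≠ c ∧ b ≠ c then threeCycleCoeff T a b c else 0) =
      threeCycleScalar lam := by
  -- Dropping the distinctness condition costs only the diagonal a = c of the two pure products; the
  -- mixed ones vanish there, since distinct entries cannot share both row and column. The remaining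
  -- sums factor through row and column lengths.
  have hpt : ∀ a b c, (if a ≠ b ∧ a ≠ c ∧ b ≠ c then threeCycleCoeff T a b c else 0) =
      (sameRow T b a * sameRow T b c + sameCol T b a * sameCol T b c) -
      ((if a = c then sameRow T b c + sameCol T b c else 0) +
      (sameRow T c b * sameCol T c a + sameRow T a c * sameCol T a b
        + sameRow T b a * sameCol T b c)) := by
    intro a b c
    by_cases hab : a = b
    · subst hab
      simp only [ne_eq, not_true_eq_false, false_and, if_false, sameRow_self, sameCol_self,
        zero_mul, mul_zero, sameRow_mul_sameCol]
      split_ifs with h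
      · subst h
        simp [sameRow_self, sameCol_self]
      · simp
    by_cases hac : a = c
    · subst hac
      simp [sameRow_self, sameCol_self, sameRow_mul_sameCol, sameRow_mul_self, sameCol_mul_self]
    by_cases hbc : b = c
    · subst hbc
      simp [hac, sameRow_self, sameCol_self, sameRow_mul_sameCol]
    rw [if_pos ⟨hab, hac, hbc⟩, if_neg hac, threeCycleCoeff, sameRow_comm T a b, sameRow_comm T b c,
      sameRow_comm T c a, sameCol_comm T a b]
    ring
  have hmid : ∀ F G : Fin n → Fin n → ℤ,
      ∑ a, ∑ b, ∑ c, F b a * G b c = ∑ b, (∑ a, F b a) * ∑ c, G b c := by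
    intro F G
    rw [Finset.sum_comm]
    simp only [Finset.sum_mul_sum]
  have hlast : ∀ F G : Fin n → Fin n → ℤ,
      ∑ a, ∑ b, ∑ c, F c b * G c a = ∑ b, (∑ a, F b a) * ∑ c, G b c := by
    intro F G
    have h1 : ∀ a, ∑ b, ∑ c, F c b * G c a = ∑ c, ∑ b, F c b * G c a := fun a => Finset.sum_comm
    simp only [h1]
    rw [Finset.sum_comm]
    refine Finset.sum_congr rfl fun a _ => ?_
    rw [Finset.sum_comm, Finset.sum_mul_sum]
  have hfirst : ∀ F G : Fin n → Fin n → ℤ,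
      ∑ a, ∑ b, ∑ c, F a c * G a b = ∑ b, (∑ a, F b a) * ∑ c, G b c := by
    intro F G
    refine Finset.sum_congr rfl fun a _ => ?_
    rw [Finset.sum_comm, Finset.sum_mul_sum]
  have hdiag : ∀ F : Fin n → Fin n → ℤ,
      ∑ a, ∑ b, ∑ c, (if a = c then F b c else 0) = ∑ b, ∑ a, F b a := by
    intro F
    simp only [Finset.sum_ite_eq, Finset.mem_univ, if_true]
    exact Finset.sum_comm
  simp only [hpt, Finset.sum_sub_distrib, Finset.sum_add_distrib, hmid, hlast, hfirst,
    hdiag fun b c => sameRow T b c + sameCol T b c, sum_sameRow, sum_sameCol]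
  rw [threeCycleScalar, ← sum_tableau T fun c => (((lam.rowLen c.1 : ℤ) - 1) * (lam.rowLen c.1 - 2)
    + ((lam.colLen c.2 : ℤ) - 1) * (lam.colLen c.2 - 2) -
      3 * (((lam.rowLen c.1 : ℤ) - 1) * (lam.colLen c.2 - 1)))]
  simp only [← Finset.sum_sub_distrib, ← Finset.sum_add_distrib]
  exact Finset.sum_congr rfl fun a _ => by ring

theorem sum_threeCycle_spechtRep (n : ℕ) (lam : YoungDiagram) :
    ∑ p : Fin n × Fin n × Fin n,
      ((if p.1 ≠ p.2.1 ∧ p.1 ≠ p.2.2 ∧ p.2.1 ≠ p.2.2 then 1 else 0 : ℤ) : ℂ) •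
        spechtRep n lam (swap p.1 p.2.1 * swap p.1 p.2.2) =
      (threeCycleScalar lam : ℂ) • 1 := by
  refine sum_spechtRep_eq_smul
    (fun p : Fin n × Fin n × Fin n =>
      if p.1 ≠ p.2.1 ∧ p.1 ≠ p.2.2 ∧ p.2.1 ≠ p.2.2 then 1 else 0)
    (fun p => swap p.1 p.2.1 * swap p.1 p.2.2) _ ?_ ?_
  · intro σ
    refine ⟨Equiv.prodCongr σ (Equiv.prodCongr σ σ), fun p => ⟨?_, ?_⟩⟩
    · simp
    · change swap (σ p.1) (σ p.2.1) * swap (σ p.1) (σ p.2.2) = _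
      rw [swap_apply_apply, swap_apply_apply]
      group
  · intro T
    have hterm : ∀ p : Fin n × Fin n × Fin n,
        ((if p.1 ≠ p.2.1 ∧ p.1 ≠ p.2.2 ∧ p.2.1 ≠ p.2.2 then 1 else 0 : ℤ) : ℂ) •
        antisymm T (tabloid T ∘ ((swap p.1 p.2.1 * swap p.1 p.2.2)⁻¹ : Perm (Fin n))) =
        ((if p.1 ≠ p.2.1 ∧ p.1 ≠ p.2.2 ∧ p.2.1 ≠ p.2.2 then
          threeCycleCoeff T p.1 p.2.1 p.2.2 else 0 : ℤ) : ℂ) • polytabloid T := by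
      intro p
      by_cases h : p.1 ≠ p.2.1 ∧ p.1 ≠ p.2.2 ∧ p.2.1 ≠ p.2.2
      · rw [if_pos h, if_pos h, antisymm_threeCycle T h.1 h.2.1 h.2.2]
        simp
      · rw [if_neg h, if_neg h]
        simp
    simp only [hterm]
    rw [← Finset.sum_smul, ← Int.cast_sum, Fintype.sum_prod_type]
    simp only [Fintype.sum_prod_type]
    rw [sum_threeCycleCoeff]

end ScalarSums

/-! ### Character ratios and T_K in terms of the two defects. -/

section CharacterRatios

open Equiv Equiv.Perm

variable {n : ℕ} {lam : YoungDiagram}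

/-- The coefficient at {T} is 1: a column-preserving permutation that also fixes the tabloid
preserves the cell of each entry. -/
theorem polytabloid_ne_zero (T : Tableau n lam) : polytabloid T ≠ 0 := by
  intro h
  have h1 : (polytabloid T) (tabloid T) = 1 := by
    unfold polytabloid
    rw [Finsupp.finsetSum_apply, Finset.sum_eq_single 1]
    · simp
    · intro σ hσ hne
      rw [Finsupp.smul_apply, entryRep_single, Finsupp.single_apply, if_neg, smul_zero]
      intro heq
      apply hne
      ext i
      have hrow := congrFun heq (σ i)
      simp only [Function.comp_apply, tabloid, ← mul_apply, inv_mul_cancel, one_apply] at hrow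
      have hcol : (T (σ i)).1.2 = (T i).1.2 := (Finset.mem_filter.1 hσ).2 i
      have := T.injective (Subtype.ext (Prod.ext hrow hcol.symm))
      rw [← this, one_apply]
    · intro h1
      exact absurd (by simp [colStabilizer]) h1
  rw [h] at h1
  simp at h1

theorem nonempty_tableau (h : lam.card = n) : Nonempty (Tableau n lam) :=
  ⟨(finCongr (by rw [← h, YoungDiagram.card])).trans lam.cells.equivFin.symm⟩

theorem nontrivial_spechtModule (h : lam.card = n) : Nontrivial (spechtModule n lam) := by
  obtain ⟨T⟩ := nonempty_tableau h
  exact ⟨⟨polytabloid T, Submodule.subset_span ⟨T, rfl⟩⟩, 0, fun h0 =>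
    polytabloid_ne_zero T (congrArg Subtype.val h0)⟩

instance : FiniteDimensional ℂ (spechtModule n lam) :=
  FiniteDimensional.span_of_finite ℂ (Set.finite_range _)

theorem sum_ite_ne (n : ℕ) :
    ∑ p : Fin n × Fin n, (if p.1 ≠ p.2 then 1 else 0 : ℝ) = n * (n - 1) := by
  have : ∀ a b : Fin n, (if a ≠ b then 1 else 0 : ℝ) = 1 - (if a = b then 1 else 0) := by
    intro a b
    split_ifs <;> simp_all
  simp only [Fintype.sum_prod_type, this, Finset.sum_sub_distrib, Finset.sum_ite_eq,
    Finset.mem_univ, if_true]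
  simp
  ring

theorem sum_ite_distinct (n : ℕ) :
    ∑ p : Fin n × Fin n × Fin n,
      (if p.1 ≠ p.2.1 ∧ p.1 ≠ p.2.2 ∧ p.2.1 ≠ p.2.2 then 1 else 0 : ℝ) =
      n * (n - 1) * (n - 2) := by
  have : ∀ a b c : Fin n, (if a ≠ b ∧ a ≠ c ∧ b ≠ c then 1 else 0 : ℝ) =
      (if a ≠ b then 1 else 0) * (1 - (if a = c then 1 else 0) - (if b = c then 1 else 0)) := by
    intro a b c
    split_ifs <;> simp_all
  have hc : ∀ a b : Fin n, ∑ c : Fin n,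
      (1 - (if a = c then 1 else 0) - (if b = c then 1 else 0) : ℝ) = n - 2 := by
    intro a b
    simp only [Finset.sum_sub_distrib, Finset.sum_ite_eq, Finset.mem_univ, if_true]
    simp
    ring
  have hc' : ∀ a b : Fin n, ∑ c : Fin n, (if a ≠ b then 1 else 0) *
      (1 - (if a = c then 1 else 0) - (if b = c then 1 else 0) : ℝ) =
      (if a ≠ b then 1 else 0) * (n - 2) := by
    intro a b
    rw [← Finset.mul_sum, hc]
  simp only [Fintype.sum_prod_type, this, hc', ← Finset.sum_mul]
  rw [← Fintype.sum_prod_type' (f := fun a b : Fin n => (if a ≠ b then 1 else 0 : ℝ)), sum_ite_ne]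

/-- For a fixed (a b), among the ordered pairs (c, d) of distinct letters, 2 use both of a and b,
4(n - 2) exactly one, and (n - 2)(n - 3) neither. -/
theorem sum_swap_mul_swap {r : Perm (Fin n) → ℝ} {r₃ r₄ : ℝ} (h₁ : r 1 = 1)
    (h₃ : ∀ a b c : Fin n, a ≠ b → a ≠ c → b ≠ c → r (swap a b * swap a c) = r₃)
    (h₄ : ∀ a b c d : Fin n, [a, b, c, d].Nodup → r (swap a b * swap c d) = r₄) :
    ∑ p : Fin n × Fin n, ∑ q : Fin n × Fin n,
      ((if p.1 ≠ p.2 then 1 else 0 : ℝ) * (if q.1 ≠ q.2 then 1 else 0)) *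
        r (swap p.1 p.2 * swap q.1 q.2) =
      n * (n - 1) * (2 + 4 * (n - 2) * r₃ + (n - 2) * (n - 3) * r₄) := by
  have hinner : ∀ a b : Fin n, a ≠ b →
      ∑ q : Fin n × Fin n, (if q.1 ≠ q.2 then 1 else 0) * r (swap a b * swap q.1 q.2) =
      2 + 4 * (n - 2) * r₃ + (n - 2) * (n - 3) * r₄ := by
    intro a b hab
    set A : Fin n → ℝ := fun c => (if a = c then 1 else 0) + (if b = c then 1 else 0) with hA
    have hA1 : ∀ c, c = a ∨ c = b → A c = 1 := by
      rintro c (rfl | rfl)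
      · simp [hA, Ne.symm hab]
      · simp [hA, hab]
    have hA0 : ∀ c, c ≠ a → c ≠ b → A c = 0 := fun c h1 h2 => by
      simp [hA, Ne.symm h1, Ne.symm h2]
    have hpt : ∀ c d : Fin n, (if c ≠ d then 1 else 0) * r (swap a b * swap c d) =
        A c * A d + (A c * (1 - A d) + (1 - A c) * A d) * r₃ + (1 - A c) * (1 - A d) * r₄
          - (if c = d then A c + (1 - A c) * r₄ else 0) := by
      intro c d
      by_cases hcd : c = d
      · subst hcd
        by_cases hc : c = a ∨ c = b
        · simp [hA1 c hc]
        · rw [not_or] at hc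
          simp [hA0 c hc.1 hc.2]
      rw [if_pos hcd, if_neg hcd, one_mul]
      by_cases hca : c = a
      · subst hca
        rw [hA1 c (.inl rfl)]
        by_cases hdb : d = b
        · rw [hA1 d (.inr hdb), hdb, swap_mul_self, h₁]; ring
        · rw [hA0 d (Ne.symm hcd) hdb, h₃ c b d hab hcd (Ne.symm hdb)]; ring
      by_cases hcb : c = b
      · subst hcb
        rw [hA1 c (.inr rfl)]
        by_cases hda : d = a
        · rw [hA1 d (.inl hda), hda, swap_comm c a, swap_mul_self, h₁]; ring
        · rw [hA0 d hda (Ne.symm hcd), swap_comm a c, h₃ c a d hab.symm hcd (Ne.symm hda)]; ring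
      rw [hA0 c hca hcb]
      by_cases hda : d = a
      · subst hda
        rw [hA1 d (.inl rfl), swap_comm c d, h₃ d b c hab (Ne.symm hcd) (Ne.symm hcb)]; ring
      by_cases hdb : d = b
      · subst hdb
        rw [hA1 d (.inr rfl), swap_comm c d, swap_comm a d,
          h₃ d a c hab.symm (Ne.symm hcd) (Ne.symm hca)]; ring
      · rw [hA0 d hda hdb, h₄ a b c d]
        · ring
        · simp [hab, Ne.symm hca, Ne.symm hda, Ne.symm hcb, Ne.symm hdb, hcd]
    have hsA : ∑ c, A c = 2 := by
      simp only [hA, Finset.sum_add_distrib, Finset.sum_ite_eq, Finset.mem_univ, if_true]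
      norm_num
    have hsA' : ∑ c, (1 - A c) = n - 2 := by
      rw [Finset.sum_sub_distrib, hsA]
      simp
    rw [Fintype.sum_prod_type]
    simp only [hpt, Finset.sum_sub_distrib, Finset.sum_add_distrib, Finset.sum_ite_eq,
      Finset.mem_univ, if_true, ← Finset.sum_mul, ← Finset.mul_sum, hsA, hsA']
    ring
  have houter : ∀ p : Fin n × Fin n, ∑ q : Fin n × Fin n,
      ((if p.1 ≠ p.2 then 1 else 0 : ℝ) * (if q.1 ≠ q.2 then 1 else 0)) *
        r (swap p.1 p.2 * swap q.1 q.2) = (if p.1 ≠ p.2 then 1 else 0) *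
        (2 + 4 * (n - 2) * r₃ + (n - 2) * (n - 3) * r₄) := by
    intro p
    simp only [mul_assoc (ite _ _ _ : ℝ), ← Finset.mul_sum]
    by_cases h : p.1 = p.2
    · simp [h]
    · rw [hinner p.1 p.2 h]
  simp only [houter]
  rw [← Finset.sum_mul, sum_ite_ne]

theorem charRatio_transpositions_spechtRep (hn : 2 ≤ n) (h : lam.card = n) :
    n * (n - 1) * charRatio (V := spechtModule n lam) (spechtRep n lam) (transpositions n hn) =
      swapScalar lam := by
  have := nontrivial_spechtModule h
  rw [← sum_charRatio_eq (V := spechtModule n lam)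
    (w := fun p : Fin n × Fin n => if p.1 ≠ p.2 then 1 else 0)
    (g := fun p => swap p.1 p.2) (sum_swap_spechtRep n lam), ← sum_ite_ne, Finset.sum_mul]
  refine Finset.sum_congr rfl fun p _ => ?_
  by_cases hp : p.1 = p.2
  · simp [hp]
  · rw [mk_swap_eq_transpositions hn hp]
    push_cast
    rfl

theorem charRatio_threeCycle_spechtRep (h : lam.card = n) {a b c : Fin n} (hab : a ≠ b)
    (hac : a ≠ c) (hbc : b ≠ c) :
    n * (n - 1) * (n - 2) *
      charRatio (V := spechtModule n lam) (spechtRep n lam) (ConjClasses.mk (swap a b * swap a c)) =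
      threeCycleScalar lam := by
  have := nontrivial_spechtModule h
  rw [← sum_charRatio_eq (V := spechtModule n lam) (w := fun p : Fin n × Fin n × Fin n =>
      if p.1 ≠ p.2.1 ∧ p.1 ≠ p.2.2 ∧ p.2.1 ≠ p.2.2 then 1 else 0)
    (g := fun p => swap p.1 p.2.1 * swap p.1 p.2.2) (sum_threeCycle_spechtRep n lam),
    ← sum_ite_distinct, Finset.sum_mul]
  refine Finset.sum_congr rfl fun p _ => ?_
  by_cases hp : p.1 ≠ p.2.1 ∧ p.1 ≠ p.2.2 ∧ p.2.1 ≠ p.2.2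
  · rw [ConjClasses.mk_eq_mk_iff_isConj.2
      (isConj_swap_mul_swap_same hp.1 hp.2.1 hp.2.2 hab hac hbc)]
    push_cast
    rfl
  · simp [hp]

theorem charRatio_doubleSwap_spechtRep (h : lam.card = n) {a b c d : Fin n}
    (hd : [a, b, c, d].Nodup) :
    n * (n - 1) * (2 + 4 * (n - 2) *
      charRatio (V := spechtModule n lam) (spechtRep n lam) (ConjClasses.mk (swap a b * swap a c)) +
      (n - 2) * (n - 3) *
      charRatio (V := spechtModule n lam) (spechtRep n lam) (ConjClasses.mk (swap a b * swap c d))) =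
      (swapScalar lam : ℝ) ^ 2 := by
  have := nontrivial_spechtModule h
  have hd' := hd
  simp only [List.nodup_cons, List.mem_cons, not_or, List.not_mem_nil] at hd'
  obtain ⟨⟨hab, hac, had, -⟩, ⟨hbc, hbd, -⟩, ⟨hcd, -⟩, -⟩ := hd'
  rw [← sum_sum_charRatio_eq (V := spechtModule n lam)
    (w := fun p : Fin n × Fin n => if p.1 ≠ p.2 then 1 else 0)
    (g := fun p => swap p.1 p.2) (sum_swap_spechtRep n lam),
    ← sum_swap_mul_swap (r := fun g =>
      charRatio (V := spechtModule n lam) (spechtRep n lam) (ConjClasses.mk g))]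
  · push_cast
    rfl
  · have hf : (Module.finrank ℂ (spechtModule n lam) : ℝ) ≠ 0 := by
      exact_mod_cast (Module.finrank_pos (R := ℂ) (M := spechtModule n lam)).ne'
    rw [charRatio_mk, Representation.char_one, Complex.natCast_re, div_self hf]
  · intro x y z hxy hxz hyz
    rw [ConjClasses.mk_eq_mk_iff_isConj.2 (isConj_swap_mul_swap_same hxy hxz hyz hab hac hbc)]
  · intro x y z w hx
    rw [ConjClasses.mk_eq_mk_iff_isConj.2 (isConj_swap_mul_swap hx hd)]

/-- The defect of the transposition scalar from its value at the trivial representation. -/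
def swapDefect (lam : YoungDiagram) : ℝ :=
  ((lam.card : ℝ) * (lam.card - 1) - swapScalar lam) / 2

/-- The defect of the `3`-cycle scalar from its value at the trivial representation. -/
def threeCycleDefect (lam : YoungDiagram) : ℝ :=
  ((lam.card : ℝ) * (lam.card - 1) * (lam.card - 2) - threeCycleScalar lam) / 3

theorem aCoeff_spechtRep (hn : 2 ≤ n) (h : lam.card = n) :
    aCoeff (V := spechtModule n lam) (transpositions n hn) (spechtRep n lam) =
      2 * swapDefect lam / (n * (n - 1)) := by
  have hn' : (2 : ℝ) ≤ n := by exact_mod_cast hn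
  have hpos : (n * (n - 1) : ℝ) ≠ 0 := mul_ne_zero (by linarith) (by linarith)
  rw [aCoeff, swapDefect, h, ← charRatio_transpositions_spechtRep hn h, eq_div_iff hpos]
  ring

theorem swapDefect_pos (hn : 2 ≤ n) (h : lam.card = n) (hT : ¬ (spechtRep n lam).IsTrivial) :
    0 < swapDefect lam := by
  have hn' : (2 : ℝ) ≤ n := by exact_mod_cast hn
  have hpos : (0 : ℝ) < n * (n - 1) := mul_pos (by linarith) (by linarith)
  have := aCoeff_transpositions_pos (V := spechtModule n lam) hn hT
  rw [aCoeff_spechtRep hn h, lt_div_iff₀ hpos] at this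
  linarith

theorem natCast_ge_of_nodup {l : List (Fin n)} (h : l.Nodup) : (l.length : ℝ) ≤ n := by
  have := h.length_le_card
  rw [Fintype.card_fin] at this
  exact_mod_cast this

theorem tTerm_threeCycle_spechtRep (hn : 2 ≤ n) (h : lam.card = n) {a b c : Fin n} (hab : a ≠ b)
    (hac : a ≠ c) (hbc : b ≠ c) :
    tTerm (V := spechtModule n lam) (transpositions n hn) (spechtRep n lam)
      (ConjClasses.mk (swap a b * swap a c)) =
      -(3 / (2 * (n - 2)) * (threeCycleDefect lam / swapDefect lam)) := by
  have hn' : (3 : ℝ) ≤ n := by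
    simpa using natCast_ge_of_nodup (l := [a, b, c]) (by simp [hab, hac, hbc])
  have h1 : (n : ℝ) ≠ 0 := by linarith
  have h2 : (n - 1 : ℝ) ≠ 0 := by linarith
  have h3 : (n - 2 : ℝ) ≠ 0 := by linarith
  rw [tTerm, aCoeff_spechtRep hn h, threeCycleDefect, h,
    ← charRatio_threeCycle_spechtRep h hab hac hbc]
  -- With zero defect both sides are 0, by the convention for division by zero.
  rcases eq_or_ne (swapDefect lam) 0 with h0 | h0
  · simp [h0]
  field_simp
  ring

theorem tTerm_doubleSwap_spechtRep (hn : 2 ≤ n) (h : lam.card = n) {a b c d : Fin n}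
    (hd : [a, b, c, d].Nodup) (h0 : swapDefect lam ≠ 0) :
    tTerm (V := spechtModule n lam) (transpositions n hn) (spechtRep n lam)
      (ConjClasses.mk (swap a b * swap c d)) =
      (2 * (swapDefect lam + 3 * (threeCycleDefect lam / swapDefect lam)) - 2 * (n * (n - 1))) /
        ((n - 2) * (n - 3)) := by
  have hn' : (4 : ℝ) ≤ n := by simpa using natCast_ge_of_nodup hd
  have h1 : (n : ℝ) ≠ 0 := by linarith
  have h2 : (n - 1 : ℝ) ≠ 0 := by linarith
  have h3 : (n - 2 : ℝ) ≠ 0 := by linarith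
  have h4 : (n - 3 : ℝ) ≠ 0 := by linarith
  have hd' := hd
  simp only [List.nodup_cons, List.mem_cons, not_or, List.not_mem_nil] at hd'
  obtain ⟨⟨hab, hac, had, -⟩, ⟨hbc, hbd, -⟩, ⟨hcd, -⟩, -⟩ := hd'
  have e4 := charRatio_doubleSwap_spechtRep h hd
  have e3 := charRatio_threeCycle_spechtRep h hab hac hbc
  have f2 : (swapScalar lam : ℝ) = n * (n - 1) - 2 * swapDefect lam := by
    rw [swapDefect, h]; ring
  have f3 : (threeCycleScalar lam : ℝ) = n * (n - 1) * (n - 2) - 3 * threeCycleDefect lam := by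
    rw [threeCycleDefect, h]; ring
  rw [f2] at e4
  rw [f3] at e3
  rw [tTerm, aCoeff_spechtRep hn h]
  set r₃ := charRatio (V := spechtModule n lam) (spechtRep n lam)
    (ConjClasses.mk (swap a b * swap a c))
  set r₄ := charRatio (V := spechtModule n lam) (spechtRep n lam)
    (ConjClasses.mk (swap a b * swap c d))
  set D := swapDefect lam
  set Q := threeCycleDefect lam
  rw [div_div_eq_mul_div, div_eq_div_iff (mul_ne_zero two_ne_zero h0) (mul_ne_zero h3 h4)]
  have hx : (2 * (D + 3 * (Q / D)) - 2 * (n * (n - 1))) * (2 * D) =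
      4 * D ^ 2 + 12 * Q - 4 * (n * (n - 1)) * D := by
    field_simp
    ring
  rw [hx]
  linear_combination e4 - 4 * e3

end CharacterRatios

/-! ### The defects as sums over rows. -/

section RowFormulas

open Finset

variable {lam : YoungDiagram} {k : ℕ}

theorem lt_colLen_zero_of_mem {c : ℕ × ℕ} (hc : c ∈ lam.cells) : c.1 < lam.colLen 0 :=
  YoungDiagram.mem_iff_lt_colLen.1 (lam.up_left_mem le_rfl (Nat.zero_le _) hc)

theorem lt_rowLen_zero_of_mem {c : ℕ × ℕ} (hc : c ∈ lam.cells) : c.2 < lam.rowLen 0 :=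
  YoungDiagram.mem_iff_lt_rowLen.1 (lam.up_left_mem (Nat.zero_le _) le_rfl hc)

theorem sum_cells_rows (f : ℕ × ℕ → ℝ) (hk : lam.colLen 0 ≤ k) :
    ∑ c ∈ lam.cells, f c = ∑ i ∈ range k, ∑ j ∈ range (lam.rowLen i), f (i, j) := by
  rw [← sum_fiberwise_of_maps_to (g := Prod.fst) (t := range k)
    fun c hc => mem_range.2 ((lt_colLen_zero_of_mem hc).trans_le hk)]
  refine sum_congr rfl fun i _ => ?_
  change ∑ c ∈ lam.row i, f c = _
  rw [YoungDiagram.row_eq_prod, sum_product, sum_singleton]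

theorem sum_cells_cols (f : ℕ × ℕ → ℝ) :
    ∑ c ∈ lam.cells, f c = ∑ j ∈ range (lam.rowLen 0), ∑ i ∈ range (lam.colLen j), f (i, j) := by
  rw [← sum_fiberwise_of_maps_to (g := Prod.snd) (t := range (lam.rowLen 0))
    fun c hc => mem_range.2 (lt_rowLen_zero_of_mem hc)]
  refine sum_congr rfl fun j _ => ?_
  change ∑ c ∈ lam.col j, f c = _
  rw [YoungDiagram.col_eq_prod, sum_product]
  simp

theorem sum_range_two_mul_add_one (m : ℕ) : ∑ i ∈ range m, (2 * (i : ℝ) + 1) = (m : ℝ) ^ 2 := by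
  induction m with
  | zero => simp
  | succ m ih => rw [sum_range_succ, ih]; push_cast; ring

theorem sum_range_cube_diff (m : ℕ) :
    ∑ i ∈ range m, (3 * (i : ℝ) ^ 2 + 3 * i + 1) = (m : ℝ) ^ 3 := by
  induction m with
  | zero => simp
  | succ m ih => rw [sum_range_succ, ih]; push_cast; ring

/-- A column of length m contributes m², the sum of the first m odd numbers; column lengths are
thereby traded for row indices. The cubes in `sum_cells_colLen_sq` play the same role. -/
theorem sum_cells_colLen :
    ∑ c ∈ lam.cells, (lam.colLen c.2 : ℝ) = ∑ c ∈ lam.cells, (2 * (c.1 : ℝ) + 1) := by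
  rw [sum_cells_cols, sum_cells_cols]
  refine sum_congr rfl fun j _ => ?_
  rw [sum_range_two_mul_add_one]
  simp only [sum_const, card_range, nsmul_eq_mul, sq]

theorem sum_cells_colLen_sq :
    ∑ c ∈ lam.cells, (lam.colLen c.2 : ℝ) ^ 2 =
      ∑ c ∈ lam.cells, (3 * (c.1 : ℝ) ^ 2 + 3 * c.1 + 1) := by
  rw [sum_cells_cols, sum_cells_cols]
  refine sum_congr rfl fun j _ => ?_
  rw [sum_range_cube_diff]
  simp only [sum_const, card_range, nsmul_eq_mul]
  ring

theorem card_eq_sum_rowLen (hk : lam.colLen 0 ≤ k) :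
    (lam.card : ℝ) = ∑ i ∈ range k, (lam.rowLen i : ℝ) := by
  have := sum_cells_rows (lam := lam) (fun _ => 1) hk
  simpa using this

theorem colLen_eq_sum (hk : lam.colLen 0 ≤ k) (j : ℕ) :
    (lam.colLen j : ℝ) = ∑ i ∈ range k, (if j < lam.rowLen i then 1 else 0 : ℝ) := by
  rw [sum_boole]
  congr 1
  have : (range k).filter (fun i => j < lam.rowLen i) = range (lam.colLen j) := by
    ext i
    rw [mem_filter, mem_range, mem_range, ← YoungDiagram.mem_iff_lt_rowLen,
      YoungDiagram.mem_iff_lt_colLen]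
    exact ⟨fun h => h.2, fun h =>
      ⟨(h.trans_le (lam.colLen_anti 0 j (Nat.zero_le _))).trans_le hk, h⟩⟩
  rw [this, card_range]

theorem sum_range_rowLen_colLen (hk : lam.colLen 0 ≤ k) {i : ℕ} (hi : i ≤ k) :
    ∑ j ∈ range (lam.rowLen i), (lam.colLen j : ℝ) =
      i * lam.rowLen i + (lam.card - ∑ i' ∈ range i, (lam.rowLen i' : ℝ)) := by
  -- Rows i and i' share min(λ_i, λ_i') columns: λ_i for rows above i, and λ_i' from row i on.
  have hmin : ∀ i', ∑ j ∈ range (lam.rowLen i), (if j < lam.rowLen i' then 1 else 0 : ℝ) =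
      (min (lam.rowLen i) (lam.rowLen i') : ℕ) := by
    intro i'
    rw [sum_boole]
    congr 1
    have : (range (lam.rowLen i)).filter (fun j => j < lam.rowLen i') =
        range (min (lam.rowLen i) (lam.rowLen i')) := by
      ext j
      simp
    rw [this, card_range]
  simp only [colLen_eq_sum hk]
  rw [sum_comm]
  simp only [hmin]
  rw [card_eq_sum_rowLen hk, ← sum_range_add_sum_Ico _ hi,
    ← sum_range_add_sum_Ico (fun i => (lam.rowLen i : ℝ)) hi, add_sub_cancel_left]
  congr 1
  · rw [sum_congr rfl (g := fun _ => (lam.rowLen i : ℝ)), sum_const, card_range, nsmul_eq_mul]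
    intro i' hi'
    rw [min_eq_left (lam.rowLen_anti _ _ (mem_range.1 hi').le)]
  · refine sum_congr rfl fun i' hi' => ?_
    rw [min_eq_right (lam.rowLen_anti _ _ (mem_Ico.1 hi').1)]

/-- The number of cells that are in the first row or below row `i`. -/
def restLen (lam : YoungDiagram) (i : ℕ) : ℝ :=
  lam.card - ∑ j ∈ range i, (lam.rowLen (j + 1) : ℝ)

theorem restLen_zero : restLen lam 0 = lam.card := by
  simp [restLen]

theorem restLen_succ (i : ℕ) : restLen lam (i + 1) = restLen lam i - lam.rowLen (i + 1) := by
  rw [restLen, restLen, sum_range_succ]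
  ring

theorem restLen_eq (hk : lam.colLen 0 ≤ k + 1) : restLen lam k = lam.rowLen 0 := by
  rw [restLen, card_eq_sum_rowLen hk, sum_range_succ']
  ring

theorem sum_range_rowLen_succ (i : ℕ) :
    ∑ j ∈ range (i + 1), (lam.rowLen j : ℝ) = lam.rowLen 0 + (lam.card - restLen lam i) := by
  rw [restLen, sum_range_succ']
  ring

/-- The contribution of row `i + 1` to the defect of the transposition scalar. -/
def rowDefect (lam : YoungDiagram) (i : ℕ) : ℝ :=
  lam.rowLen (i + 1) * (restLen lam (i + 1) + (i + 1))

theorem swapScalar_eq (hk : lam.colLen 0 ≤ k) :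
    (swapScalar lam : ℝ) =
      ∑ i ∈ range k, ((lam.rowLen i : ℝ) ^ 2 - (2 * i + 1) * lam.rowLen i) := by
  rw [swapScalar]
  push_cast
  rw [sum_sub_distrib, sum_cells_colLen, ← sum_sub_distrib, sum_cells_rows _ hk]
  refine sum_congr rfl fun i _ => ?_
  simp only [sum_const, card_range, nsmul_eq_mul]
  ring

theorem threeCycleScalar_eq (hk : lam.colLen 0 ≤ k) :
    (threeCycleScalar lam : ℝ) =
      ∑ i ∈ range k, (lam.rowLen i * ((lam.rowLen i - 1) * (lam.rowLen i - 2) +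
        (3 * (i : ℝ) ^ 2 + 3 * i + 1) - 1 + 3 * lam.rowLen i) -
        3 * lam.rowLen i * (i * lam.rowLen i +
          (lam.card - ∑ i' ∈ range i, (lam.rowLen i' : ℝ)))) := by
  rw [threeCycleScalar]
  push_cast
  -- The terms linear in the column length cancel; only its square and its product with the row
  -- length remain.
  have e : ∀ c : ℕ × ℕ, ((lam.rowLen c.1 : ℝ) - 1) * (lam.rowLen c.1 - 2) +
    ((lam.colLen c.2 : ℝ) - 1) * (lam.colLen c.2 - 2) -
      3 * (((lam.rowLen c.1 : ℝ) - 1) * (lam.colLen c.2 - 1)) =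
    (((lam.rowLen c.1 : ℝ) - 1) * (lam.rowLen c.1 - 2) - 1 + 3 * lam.rowLen c.1) +
      (lam.colLen c.2 : ℝ) ^ 2 - 3 * (lam.rowLen c.1 * lam.colLen c.2) := by
    intro c
    ring
  simp only [e]
  rw [sum_sub_distrib, sum_add_distrib, sum_cells_colLen_sq, ← sum_add_distrib,
    ← sum_sub_distrib, sum_cells_rows _ hk]
  refine sum_congr rfl fun i hi => ?_
  rw [← sum_range_rowLen_colLen hk (mem_range.1 hi).le, sum_sub_distrib]
  simp only [sum_const, card_range, nsmul_eq_mul, ← mul_sum]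
  ring

/-- With R_i = `restLen lam i`, the value n(n - 1) telescopes along R(R - 1) from R_0 = n down to
R_k = λ_0, and the end term cancels the contribution of row 0. -/
theorem swapDefect_eq_sum (hk : lam.colLen 0 ≤ k + 1) :
    swapDefect lam = ∑ i ∈ range k, rowDefect lam i := by
  have htel : (lam.card : ℝ) * (lam.card - 1) = lam.rowLen 0 * (lam.rowLen 0 - 1) +
      ∑ i ∈ range k, (restLen lam i * (restLen lam i - 1) -
        restLen lam (i + 1) * (restLen lam (i + 1) - 1)) := by
    rw [sum_range_sub' (fun i => restLen lam i * (restLen lam i - 1)), restLen_zero, restLen_eq hk]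
    ring
  have h0 : (lam.rowLen 0 : ℝ) ^ 2 - (2 * (0 : ℕ) + 1) * lam.rowLen 0 =
      lam.rowLen 0 * (lam.rowLen 0 - 1) := by
    push_cast; ring
  rw [swapDefect, swapScalar_eq hk, sum_range_succ', htel, h0, add_comm (_ * _ : ℝ),
    add_sub_add_right_eq_sub,
    ← sum_sub_distrib, sum_div]
  refine sum_congr rfl fun i _ => ?_
  rw [rowDefect, restLen_succ]
  push_cast
  ring

/-- The same telescoping with R(R - 1)(R - 2). Row 0 leaves the cross term 3λ_0(n - λ_0), which is
distributed over the other rows; each summand is then a multiple of `rowDefect lam i`. -/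
theorem threeCycleDefect_eq_sum (hk : lam.colLen 0 ≤ k + 1) :
    threeCycleDefect lam = ∑ i ∈ range k, (restLen lam i - 2 - i) * rowDefect lam i := by
  have htel : (lam.card : ℝ) * (lam.card - 1) * (lam.card - 2) =
      lam.rowLen 0 * (lam.rowLen 0 - 1) * (lam.rowLen 0 - 2) +
      ∑ i ∈ range k, (restLen lam i * (restLen lam i - 1) * (restLen lam i - 2) -
        restLen lam (i + 1) * (restLen lam (i + 1) - 1) * (restLen lam (i + 1) - 2)) := by
    rw [sum_range_sub' (fun i => restLen lam i * (restLen lam i - 1) * (restLen lam i - 2)),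
      restLen_zero, restLen_eq hk]
    ring
  have hn : (lam.card : ℝ) = lam.rowLen 0 + ∑ i ∈ range k, (lam.rowLen (i + 1) : ℝ) := by
    rw [card_eq_sum_rowLen hk, sum_range_succ', add_comm]
  rw [threeCycleDefect, threeCycleScalar_eq hk, sum_range_succ', htel]
  simp only [sum_range_rowLen_succ, sum_range_zero]
  have h0 : (lam.rowLen 0 * ((lam.rowLen 0 - 1) * (lam.rowLen 0 - 2) +
        (3 * ((0 : ℕ) : ℝ) ^ 2 + 3 * (0 : ℕ) + 1) - 1 + 3 * lam.rowLen 0) -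
        3 * lam.rowLen 0 * ((0 : ℕ) * lam.rowLen 0 + (lam.card - 0)) : ℝ) =
      lam.rowLen 0 * (lam.rowLen 0 - 1) * (lam.rowLen 0 - 2) -
        ∑ i ∈ range k, 3 * lam.rowLen 0 * (lam.rowLen (i + 1) : ℝ) := by
    rw [← mul_sum, hn]; push_cast; ring
  have harr : ∀ x y z w : ℝ, x + y - (z + (x - w)) = y + w - z := by
    intros
    ring
  rw [h0, harr, ← sum_add_distrib, ← sum_sub_distrib, sum_div]
  refine sum_congr rfl fun i _ => ?_
  rw [rowDefect, restLen_succ]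
  push_cast
  ring

end RowFormulas

/-! ### Comparison of the defects under succession. -/

section Monotonicity

open Finset

variable {lam mu : YoungDiagram} {k : ℕ}

theorem rowLen_eq_zero {i : ℕ} (hi : lam.colLen 0 ≤ i) : lam.rowLen i = 0 := by
  by_contra h
  have : (i, 0) ∈ lam := YoungDiagram.mem_iff_lt_rowLen.2 (Nat.pos_of_ne_zero h)
  exact absurd (YoungDiagram.mem_iff_lt_colLen.1 this) (by omega)

theorem one_le_rowLen {i : ℕ} (hi : i < lam.colLen 0) : 1 ≤ lam.rowLen i :=
  YoungDiagram.mem_iff_lt_rowLen.1 (YoungDiagram.mem_iff_lt_colLen.2 hi)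

theorem restLen_antitone : Antitone (restLen lam) :=
  antitone_nat_of_succ_le fun i => by
    rw [restLen_succ]
    exact sub_le_self _ (Nat.cast_nonneg _)

theorem rowLen_zero_le_restLen (i : ℕ) : (lam.rowLen 0 : ℝ) ≤ restLen lam i := by
  rw [← restLen_eq (lam := lam) (k := max i (lam.colLen 0)) (by omega)]
  exact restLen_antitone (le_max_left _ _)

theorem rowDefect_nonneg (i : ℕ) : 0 ≤ rowDefect lam i := by
  have := rowLen_zero_le_restLen (lam := lam) (i + 1)
  unfold rowDefect
  have h0 : (0 : ℝ) ≤ lam.rowLen 0 := Nat.cast_nonneg _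
  exact mul_nonneg (Nat.cast_nonneg _) (by have : (0 : ℝ) ≤ i := Nat.cast_nonneg i; linarith)

/-- With s_i = R_i - 2 - i, the drop s_0 - s_j is X + j, where X = λ_1 + ... + λ_j counting rows
from 0. Each of the rows 1, ..., j + 1 contributes to the defect at least λ_0 + j + 1 times its
length. -/
theorem three_mul_le_swapDefect {j : ℕ} (hj : j + 1 < lam.colLen 0) :
    3 * ((restLen lam 0 - 2) - (restLen lam j - 2 - j)) ≤ swapDefect lam := by
  have hm0 : (1 : ℝ) ≤ lam.rowLen 0 := by exact_mod_cast one_le_rowLen (by omega)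
  have hrow : ∀ i ≤ j, (1 : ℝ) ≤ lam.rowLen (i + 1) := fun i hi => by
    exact_mod_cast one_le_rowLen (by omega)
  -- As long as the rows are nonempty, R_b + b does not increase with b, so its value at b = j + 1
  -- is a lower bound.
  have hanti : ∀ i ≤ j, (lam.rowLen 0 : ℝ) + (j + 1) ≤ restLen lam (i + 1) + (i + 1) := by
    intro i hi
    have : ∀ b, i + 1 ≤ b → b ≤ j + 1 → restLen lam b + b ≤ restLen lam (i + 1) + (i + 1) := by
      intro b hb
      induction b, hb using Nat.le_induction with
      | base => intro _; push_cast; exact le_rfl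
      | succ b hb ih =>
        intro hbj
        have h1 := ih (by omega)
        have h2 := hrow b (by omega)
        rw [restLen_succ]
        push_cast
        linarith
    have h1 := this (j + 1) (by omega) le_rfl
    have h2 := rowLen_zero_le_restLen (lam := lam) (j + 1)
    push_cast at h1
    linarith
  set X := ∑ i ∈ range j, (lam.rowLen (i + 1) : ℝ) with hX
  have hXj : (j : ℝ) ≤ X := by
    have : ∑ i ∈ range j, (1 : ℝ) ≤ X :=
      sum_le_sum fun i hi => hrow i (mem_range.1 hi).le
    simpa using this
  have hD : ((lam.rowLen 0 : ℝ) + (j + 1)) * (X + 1) ≤ swapDefect lam := by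
    rw [swapDefect_eq_sum (k := lam.colLen 0) (by omega)]
    have hsub : ∑ i ∈ range (j + 1), rowDefect lam i ≤ ∑ i ∈ range (lam.colLen 0), rowDefect lam i :=
      sum_le_sum_of_subset_of_nonneg (range_subset_range.2 (by omega))
        fun i _ _ => rowDefect_nonneg i
    refine le_trans ?_ hsub
    have hle : ∑ i ∈ range (j + 1), (lam.rowLen (i + 1) : ℝ) * (lam.rowLen 0 + (j + 1)) ≤
        ∑ i ∈ range (j + 1), rowDefect lam i :=
      sum_le_sum fun i hi => mul_le_mul_of_nonneg_left
        (hanti i (Nat.lt_succ_iff.1 (mem_range.1 hi))) (Nat.cast_nonneg _)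
    refine le_trans ?_ hle
    rw [← sum_mul, sum_range_succ, mul_comm]
    refine mul_le_mul_of_nonneg_right ?_ (by positivity)
    linarith [hrow j le_rfl]
  refine le_trans ?_ hD
  have hs : restLen lam 0 - 2 - (restLen lam j - 2 - j) = X + j := by
    rw [restLen_zero, restLen]
    ring
  rw [hs]
  -- The difference of the sides is (j - 1)(X - 2): nonnegative for j ≥ 2 as X ≥ j, zero for j = 1,
  -- and 2 for j = 0, where X = 0.
  have key : 3 * (X + j) ≤ (1 + (j + 1)) * (X + 1) := by
    rcases Nat.lt_or_ge j 2 with h | h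
    · interval_cases j
      · have : X = 0 := by simp [hX]
        rw [this]; norm_num
      · push_cast; linarith
    · have h2 : (2 : ℝ) ≤ j := by exact_mod_cast h
      nlinarith
  refine key.trans (mul_le_mul_of_nonneg_right (by linarith) ?_)
  have : (0 : ℝ) ≤ j := Nat.cast_nonneg j
  linarith

/-- The part quadratic in d cancels, so the change of the weighted mean of s is governed by the
pairs of an old weight d_i and an added weight e_j. -/
theorem sum_mul_sum_sub (k : ℕ) (d e s : ℕ → ℝ) :
    (∑ i ∈ range k, d i) * ∑ i ∈ range k, s i * (d i + e i) -
      (∑ i ∈ range k, s i * d i) * ∑ i ∈ range k, (d i + e i) =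
      ∑ i ∈ range k, ∑ j ∈ range k, d i * e j * (s j - s i) := by
  have : ∀ i j, d i * e j * (s j - s i) = d i * (s j * e j) - (s i * d i) * e j := by
    intros; ring
  simp only [this, sum_sub_distrib, ← sum_mul_sum, mul_add, sum_add_distrib]
  ring

/-- The comparison of the defects of two partitions in succession. -/
theorem defects_of_succeeds (hcard : lam.card = mu.card) (hD : swapDefect lam ≠ 0)
    (h : Succeeds lam mu) :
    swapDefect lam ≤ swapDefect mu ∧
    swapDefect lam * threeCycleDefect mu ≤ threeCycleDefect lam * swapDefect mu ∧
    -(swapDefect mu * swapDefect lam * (swapDefect mu - swapDefect lam)) ≤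
      3 * (swapDefect lam * threeCycleDefect mu - threeCycleDefect lam * swapDefect mu) := by
  -- At most one row would give zero defect. The last row of `lam` has index p + 1 and enters as the
  -- defect term of index p.
  obtain ⟨p, hp⟩ : ∃ p, lam.colLen 0 = p + 2 := by
    refine ⟨lam.colLen 0 - 2, ?_⟩
    by_contra hlt
    apply hD
    rw [swapDefect_eq_sum (k := 0) (by omega), sum_range_zero]
  obtain ⟨-, hmid, hlast⟩ := h
  have hmid' : ∀ i < p, lam.rowLen (i + 1) = mu.rowLen (i + 1) := fun i hi =>
    hmid (i + 1) (by omega) (by omega)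
  have hlast' : lam.rowLen (p + 1) ≤ mu.rowLen (p + 1) := by
    rwa [hp, show p + 2 - 1 = p + 1 by omega] at hlast
  have hrest : ∀ i ≤ p, restLen lam i = restLen mu i := by
    intro i hi
    rw [restLen, restLen, hcard]
    congr 1
    exact sum_congr rfl fun j hj => by rw [hmid' j ((mem_range.1 hj).trans_le hi)]
  have hlt : ∀ i < p, rowDefect lam i = rowDefect mu i := by
    intro i hi
    rw [rowDefect, rowDefect, hmid' i hi, hrest (i + 1) hi]
  have hgt : ∀ i, p < i → rowDefect lam i = 0 := by
    intro i hi
    rw [rowDefect, rowLen_eq_zero (by omega), Nat.cast_zero, zero_mul]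
  -- For row lengths r ≤ r' and common R = R_p, the difference is (r' - r)(R + p + 1 - r - r'), and
  -- R - r' ≥ μ_0 ≥ r' ≥ r.
  have heq : rowDefect lam p ≤ rowDefect mu p := by
    rw [rowDefect, rowDefect, restLen_succ, restLen_succ, hrest p le_rfl]
    have h1 := rowLen_zero_le_restLen (lam := mu) (p + 1)
    rw [restLen_succ] at h1
    have h2 : (mu.rowLen (p + 1) : ℝ) ≤ mu.rowLen 0 := by
      exact_mod_cast mu.rowLen_anti 0 (p + 1) (Nat.zero_le _)
    have h3 : (lam.rowLen (p + 1) : ℝ) ≤ mu.rowLen (p + 1) := by exact_mod_cast hlast'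
    have h4 : (0 : ℝ) ≤ p := Nat.cast_nonneg p
    nlinarith
  set k := max (lam.colLen 0) (mu.colLen 0) with hk
  set e : ℕ → ℝ := fun i => rowDefect mu i - rowDefect lam i with he
  have he0 : ∀ i, 0 ≤ e i := by
    intro i
    rcases lt_trichotomy i p with h | rfl | h
    · exact (sub_eq_zero.2 (hlt i h).symm).ge
    · exact sub_nonneg.2 heq
    · rw [he]
      simp only [hgt i h, sub_zero]
      exact rowDefect_nonneg i
  have hadd : ∀ i, rowDefect mu i = rowDefect lam i + e i := fun i => by simp [he]
  set s : ℕ → ℝ := fun i => restLen mu i - 2 - i with hs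
  have hsanti : Antitone s := fun i j hij => by
    have h1 := restLen_antitone (lam := mu) hij
    have h2 : (i : ℝ) ≤ j := by exact_mod_cast hij
    simp only [hs]
    linarith
  have hDl : swapDefect lam = ∑ i ∈ range k, rowDefect lam i := swapDefect_eq_sum (by omega)
  have hDm : swapDefect mu = ∑ i ∈ range k, (rowDefect lam i + e i) := by
    rw [swapDefect_eq_sum (k := k) (by omega)]
    exact sum_congr rfl fun i _ => hadd i
  have hQm : threeCycleDefect mu = ∑ i ∈ range k, s i * (rowDefect lam i + e i) := by
    rw [threeCycleDefect_eq_sum (k := k) (by omega)]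
    exact sum_congr rfl fun i _ => by rw [hadd i]
  have hQl : threeCycleDefect lam = ∑ i ∈ range k, s i * rowDefect lam i := by
    rw [threeCycleDefect_eq_sum (k := k) (by omega)]
    refine sum_congr rfl fun i _ => ?_
    rcases le_or_gt i p with h | h
    · rw [hrest i h]
    · rw [hgt i h, mul_zero, mul_zero]
  have hdiff : swapDefect lam * threeCycleDefect mu - threeCycleDefect lam * swapDefect mu =
      ∑ i ∈ range k, ∑ j ∈ range k, rowDefect lam i * e j * (s j - s i) := by
    rw [← sum_mul_sum_sub, hDm, hQm, hQl, hDl]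
  have hW : swapDefect mu - swapDefect lam = ∑ i ∈ range k, e i := by
    rw [hDm, hDl, sum_add_distrib, add_sub_cancel_left]
  refine ⟨?_, ?_, ?_⟩
  · rw [← sub_nonneg, hW]
    exact sum_nonneg fun i _ => he0 i
  · rw [← sub_nonpos, hdiff]
    refine sum_nonpos fun i _ => sum_nonpos fun j _ => ?_
    -- Only i ≤ p ≤ j survive, and there s_j ≤ s_i.
    rcases lt_or_ge p i with h | hi
    · rw [hgt i h, zero_mul, zero_mul]
    rcases lt_or_ge j p with h | hj
    · have : e j = 0 := sub_eq_zero.2 (hlt j h).symm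
      rw [this, mul_zero, zero_mul]
    exact mul_nonpos_of_nonneg_of_nonpos (mul_nonneg (rowDefect_nonneg i) (he0 j))
      (sub_nonpos.2 (hsanti (hi.trans hj)))
  · rw [hdiff, hW, mul_assoc, hDl, sum_mul_sum, mul_sum, mul_sum, ← sum_neg_distrib]
    refine sum_le_sum fun i _ => ?_
    rw [mul_sum, mul_sum, ← sum_neg_distrib]
    refine sum_le_sum fun j _ => ?_
    have hnn := mul_nonneg (rowDefect_nonneg (lam := lam) i) (he0 j)
    -- A nonzero e_j forces row j + 1 of `mu` to be nonempty, so `three_mul_le_swapDefect` applies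
    -- to `mu`; also s_i ≤ s_0.
    have hkey : rowDefect lam i * e j ≠ 0 → 3 * (s i - s j) ≤ swapDefect mu := by
      intro hne
      have hmj : mu.rowLen (j + 1) ≠ 0 := by
        intro h0
        have h1 : rowDefect mu j = 0 := by rw [rowDefect, h0, Nat.cast_zero, zero_mul]
        have h2 : e j = 0 := le_antisymm
          (by simp only [he]; linarith [rowDefect_nonneg (lam := lam) j]) (he0 j)
        exact hne (by rw [h2, mul_zero])
      have hjlt : j + 1 < mu.colLen 0 := by
        by_contra h
        exact hmj (rowLen_eq_zero (by omega))
      have h1 := three_mul_le_swapDefect hjlt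
      have h2 := hsanti (Nat.zero_le i)
      simp only [hs] at h2 ⊢
      push_cast at h2
      linarith
    by_cases hne : rowDefect lam i * e j = 0
    · rw [hne]; simp
    · nlinarith [hkey hne]

theorem threeCycleDefect_div_le (hcard : lam.card = mu.card) (hD : 0 < swapDefect lam)
    (hD' : 0 < swapDefect mu) (h : Succeeds lam mu) :
    threeCycleDefect mu / swapDefect mu ≤ threeCycleDefect lam / swapDefect lam := by
  rw [div_le_div_iff₀ hD' hD]
  linarith [(defects_of_succeeds hcard hD.ne' h).2.1]

theorem swapDefect_add_le (hcard : lam.card = mu.card) (hD : 0 < swapDefect lam)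
    (hD' : 0 < swapDefect mu) (h : Succeeds lam mu) :
    swapDefect lam + 3 * (threeCycleDefect lam / swapDefect lam) ≤
      swapDefect mu + 3 * (threeCycleDefect mu / swapDefect mu) := by
  have h3 := (defects_of_succeeds hcard hD.ne' h).2.2
  have e : swapDefect mu + 3 * (threeCycleDefect mu / swapDefect mu) -
      (swapDefect lam + 3 * (threeCycleDefect lam / swapDefect lam)) =
      (swapDefect mu * swapDefect lam * (swapDefect mu - swapDefect lam) +
        3 * (swapDefect lam * threeCycleDefect mu - threeCycleDefect lam * swapDefect mu)) /
        (swapDefect lam * swapDefect mu) := by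
    field_simp
    ring
  rw [← sub_nonneg, e]
  exact div_nonneg (by linarith) (mul_pos hD hD').le

end Monotonicity

/-! ### Irreducibility of the shape (n - 1, 1) and its extremal values. -/

section Standard

open Equiv Equiv.Perm

theorem entryRep_apply {n : ℕ} (σ : Perm (Fin n)) (u : (Fin n → ℕ) →₀ ℂ) (f : Fin n → ℕ) :
    entryRep n σ u f = u (f ∘ σ) := by
  have hinj : Function.Injective fun f : Fin n → ℕ => f ∘ (σ⁻¹ : Perm (Fin n)) := fun f g h => by
    funext i
    simpa using congrFun h (σ i)
  have := Finsupp.mapDomain_apply hinj u (f ∘ σ)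
  have hf : (f ∘ σ) ∘ (σ⁻¹ : Perm (Fin n)) = f := by
    funext i
    simp
  simp only [hf] at this
  exact this

theorem colAntisymmetrizer_apply_tabloid {n : ℕ} {lam : YoungDiagram} (T : Tableau n lam)
    (u : (Fin n → ℕ) →₀ ℂ) :
    colAntisymmetrizer T u (tabloid T) =
      ∑ σ ∈ colStabilizer T, ((sign σ : ℤ) : ℂ) * u (tabloid T ∘ (σ⁻¹ : Perm (Fin n))) := by
  simp only [colAntisymmetrizer, LinearMap.sum_apply, LinearMap.smul_apply,
    Finsupp.finsetSum_apply, Finsupp.smul_apply, entryRep_apply, smul_eq_mul]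
  refine Finset.sum_bij' (fun σ _ => σ⁻¹) (fun σ _ => σ⁻¹) ?_ ?_ ?_ ?_ ?_
  iterate 2
    intro σ hσ
    simp only [colStabilizer, Finset.mem_filter, Finset.mem_univ, true_and] at hσ ⊢
    intro i
    have := hσ (σ⁻¹ i)
    rw [← mul_apply, mul_inv_cancel, one_apply] at this
    exact this.symm
  · intro σ _; exact inv_inv σ
  · intro σ _; exact inv_inv σ
  · intro σ _; rw [sign_inv, inv_inv]

open ComplexConjugate in
/-- A vector of the Specht module that is killed by all column antisymmetrizers vanishes. -/
theorem eq_zero_of_colAntisymmetrizer_eq_zero {n : ℕ} {lam : YoungDiagram}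
    {u : (Fin n → ℕ) →₀ ℂ} (hu : u ∈ spechtModule n lam)
    (h : ∀ T : Tableau n lam, colAntisymmetrizer T u = 0) : u = 0 := by
  -- The Hermitian pairing with u. Its value at the polytabloid of T is the conjugate of the
  -- coefficient of {T} in κ_T u, hence 0; so u is orthogonal to the Specht module, in particular to
  -- itself.
  set B := Finsupp.linearCombination ℂ (fun f => conj (u f)) with hB
  have hBe : ∀ T : Tableau n lam, B (polytabloid T) = 0 := by
    intro T
    have h1 := colAntisymmetrizer_apply_tabloid T u
    rw [h T, Finsupp.zero_apply] at h1
    simp only [polytabloid, map_sum, map_smul, entryRep_single, hB,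
      Finsupp.linearCombination_single, smul_eq_mul]
    have := congrArg conj h1.symm
    rw [map_sum, map_zero] at this
    simpa using this
  have hBv : ∀ v ∈ spechtModule n lam, B v = 0 := by
    intro v hv
    have : spechtModule n lam ≤ LinearMap.ker B := Submodule.span_le.2 (by
      rintro _ ⟨T, rfl⟩
      exact hBe T)
    exact this hv
  have h0 := hBv u hu
  rw [hB, Finsupp.linearCombination_apply, Finsupp.sum] at h0
  ext f
  by_contra hf
  have hre := congrArg Complex.re h0
  rw [Complex.re_sum, Complex.zero_re] at hre
  have hterm : ∀ f, (u f • conj (u f)).re = Complex.normSq (u f) := fun f => by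
    rw [smul_eq_mul, Complex.mul_conj, Complex.ofReal_re]
  simp only [hterm] at hre
  rw [Finset.sum_eq_zero_iff_of_nonneg fun _ _ => Complex.normSq_nonneg _] at hre
  exact hf (Complex.normSq_eq_zero.1 (hre f (Finsupp.mem_support_iff.2 hf)))

/-- If the column antisymmetrizers map every tabloid to a multiple of the polytabloid, then the
Specht module is irreducible. -/
theorem isIrreducible_spechtRep {n : ℕ} {lam : YoungDiagram} (hcard : lam.card = n)
    (h : ∀ T T' : Tableau n lam, antisymm T (tabloid T') ∈ Submodule.span ℂ {polytabloid T}) :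
    Representation.IsIrreducible (k := ℂ) (V := spechtModule n lam) (spechtRep n lam) := by
  have hnt := nontrivial_spechtModule hcard
  have hκ : ∀ T : Tableau n lam, ∀ u ∈ spechtModule n lam,
      colAntisymmetrizer T u ∈ Submodule.span ℂ {polytabloid T} := by
    intro T u hu
    have : spechtModule n lam ≤
        (Submodule.span ℂ {polytabloid T}).comap (colAntisymmetrizer T) := Submodule.span_le.2 (by
      rintro _ ⟨T', rfl⟩
      change colAntisymmetrizer T (polytabloid T') ∈ Submodule.span ℂ {polytabloid T}
      unfold polytabloid
      rw [map_sum]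
      refine Submodule.sum_mem _ fun σ _ => ?_
      rw [map_smul, entryRep_single]
      exact Submodule.smul_mem _ _ (h T ((σ⁻¹ : Perm (Fin n)).trans T')))
    exact this hu
  refine { exists_pair_ne := ⟨⊥, ⊤, ?_⟩, eq_bot_or_eq_top := ?_ }
  · intro hbt
    obtain ⟨v, hv⟩ := exists_ne (0 : spechtModule n lam)
    have : v ∈ (⊤ : Subrepresentation (spechtRep n lam)).toSubmodule := Submodule.mem_top
    rw [← hbt] at this
    exact hv ((Submodule.mem_bot ℂ).1 this)
  · intro U
    by_cases hU : ∃ u ∈ U.toSubmodule, u ≠ 0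
    swap
    · left
      push Not at hU
      apply Subrepresentation.toSubmodule_injective
      exact (Submodule.eq_bot_iff _).2 hU
    right
    obtain ⟨u, huU, hu0⟩ := hU
    have hT : ∃ T : Tableau n lam, colAntisymmetrizer T u.1 ≠ 0 := by
      by_contra hcon
      push Not at hcon
      exact hu0 (Subtype.ext (eq_zero_of_colAntisymmetrizer_eq_zero u.2 hcon))
    obtain ⟨T, hT⟩ := hT
    set W := U.toSubmodule.map (spechtModule n lam).subtype with hW
    have hWρ : ∀ σ, ∀ w ∈ W, entryRep n σ w ∈ W := by
      rintro σ _ ⟨w, hw, rfl⟩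
      exact ⟨spechtRep n lam σ w, U.apply_mem_toSubmodule σ hw, rfl⟩
    have hκW : colAntisymmetrizer T u.1 ∈ W := by
      rw [colAntisymmetrizer, LinearMap.sum_apply]
      exact Submodule.sum_mem _ fun σ _ => Submodule.smul_mem _ _ (hWρ σ _ ⟨u, huU, rfl⟩)
    -- A nonzero multiple of one polytabloid lies in the subrepresentation, and the symmetric group
    -- permutes tableaux transitively, so every polytabloid does.
    obtain ⟨a, ha⟩ := Submodule.mem_span_singleton.1 (hκ T u.1 u.2)
    have ha0 : a ≠ 0 := by
      rintro rfl
      exact hT (by rw [← ha, zero_smul])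
    rw [← ha, Submodule.smul_mem_iff _ ha0] at hκW
    have hall : ∀ T' : Tableau n lam, polytabloid T' ∈ W := by
      intro T'
      have := hWρ (T.trans T'.symm) _ hκW
      rw [entryRep_polytabloid] at this
      convert this using 2
      ext i : 1
      change T' i = T (T.symm (T' i))
      rw [apply_symm_apply]
    have hle : spechtModule n lam ≤ W := Submodule.span_le.2 (by
      rintro _ ⟨T', rfl⟩
      exact hall T')
    apply Subrepresentation.toSubmodule_injective
    change U.toSubmodule = ⊤
    rw [eq_top_iff]
    intro v _
    obtain ⟨w, hw, hwv⟩ := hle v.2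
    rw [← Subtype.ext hwv]
    exact hw

theorem charRatio_of_isTrivial {G V : Type*} [Group G] [AddCommGroup V] [Module ℂ V]
    [FiniteDimensional ℂ V] [Nontrivial V] {ρ : Representation ℂ G V} (h : ρ.IsTrivial) (g : G) :
    charRatio ρ (ConjClasses.mk g) = 1 := by
  have hf : (Module.finrank ℂ V : ℝ) ≠ 0 := by exact_mod_cast Module.finrank_pos.ne'
  rw [charRatio_mk, Representation.character, h.out, LinearMap.trace_id, Complex.natCast_re,
    div_self hf]

variable {n : ℕ} (hn : 2 ≤ n)

theorem rowLens_standardShape : (standardShape n hn).rowLens = [n - 1, 1] := by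
  refine YoungDiagram.rowLens_ofRowLens_eq_self ?_
  intro x hx
  simp at hx
  omega

theorem colLen_standardShape : (standardShape n hn).colLen 0 = 2 := by
  rw [← YoungDiagram.length_rowLens, rowLens_standardShape]
  rfl

theorem rowLen_standardShape_zero : (standardShape n hn).rowLen 0 = n - 1 :=
  YoungDiagram.rowLen_ofRowLens (w := [n - 1, 1]) ⟨0, by simp⟩

theorem rowLen_standardShape_one : (standardShape n hn).rowLen 1 = 1 :=
  YoungDiagram.rowLen_ofRowLens (w := [n - 1, 1]) ⟨1, by simp⟩

theorem card_standardShape : (standardShape n hn).card = n := by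
  have h := card_eq_sum_rowLen (lam := standardShape n hn) (k := 2) (colLen_standardShape hn).le
  rw [Finset.sum_range_succ, Finset.sum_range_one, rowLen_standardShape_zero,
    rowLen_standardShape_one, ← Nat.cast_add, Nat.cast_inj] at h
  omega

theorem swapDefect_standardShape : swapDefect (standardShape n hn) = n := by
  rw [swapDefect_eq_sum (k := 1) (colLen_standardShape hn).le, Finset.sum_range_one, rowDefect,
    restLen_succ, restLen_zero, card_standardShape, rowLen_standardShape_one]
  push_cast
  ring

theorem threeCycleDefect_standardShape :
    threeCycleDefect (standardShape n hn) = (n - 2) * n := by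
  rw [threeCycleDefect_eq_sum (k := 1) (colLen_standardShape hn).le, Finset.sum_range_one,
    rowDefect, restLen_succ, restLen_zero, card_standardShape, rowLen_standardShape_one]
  push_cast
  ring

theorem isIrreducible_standard :
    Representation.IsIrreducible (k := ℂ) (V := spechtModule n (standardShape n hn))
      (spechtRep n (standardShape n hn)) := by
  refine isIrreducible_spechtRep (card_standardShape hn) fun T T' => ?_
  have h10 : (1, 0) ∈ (standardShape n hn).cells :=
    YoungDiagram.mem_iff_lt_rowLen.2 (by rw [rowLen_standardShape_one]; norm_num)
  have h00 : (0, 0) ∈ (standardShape n hn).cells :=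
    YoungDiagram.mem_iff_lt_rowLen.2 (by rw [rowLen_standardShape_zero]; omega)
  -- A tabloid of this shape is determined by its one entry in the second row. If that entry of T'
  -- is neither q nor p, the first column of T, then q and p share a row of T' and the
  -- antisymmetrizer kills it.
  have htab : ∀ T : Tableau n (standardShape n hn),
      tabloid T = fun i => if i = T.symm ⟨_, h10⟩ then 1 else 0 := by
    intro T
    funext i
    split_ifs with hi
    · rw [hi, tabloid, apply_symm_apply]
    · have h1 : (T i).1.1 < 2 := by
        rw [← colLen_standardShape hn]
        exact lt_colLen_zero_of_mem (T i).2
      have h2 : (T i).1.1 ≠ 1 := by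
        intro h1
        apply hi
        rw [eq_symm_apply]
        refine Subtype.ext (Prod.ext h1 ?_)
        have : (T i).1.2 < (standardShape n hn).rowLen (T i).1.1 :=
          YoungDiagram.mem_iff_lt_rowLen.1 (T i).2
        rw [h1, rowLen_standardShape_one] at this
        change (T i).1.2 = 0
        omega
      change (T i).1.1 = 0
      omega
  set q := T.symm ⟨_, h10⟩ with hq
  set p := T.symm ⟨_, h00⟩ with hp
  set q' := T'.symm ⟨_, h10⟩ with hq'
  have hqp : q ≠ p := by
    intro h
    have := T.symm.injective h
    simp at this
  have hcol : (T q).1.2 = (T p).1.2 := by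
    rw [hq, hp, apply_symm_apply, apply_symm_apply]
  have hself : antisymm T (tabloid T) ∈ Submodule.span ℂ {polytabloid T} := by
    rw [antisymm, colAntisymmetrizer_tabloid]
    exact Submodule.mem_span_singleton_self _
  by_cases h1 : q' = q
  · have : tabloid T' = tabloid T := by rw [htab T, htab T', ← hq, ← hq', h1]
    rw [this]
    exact hself
  by_cases h2 : q' = p
  · have : tabloid T' = tabloid T ∘ swap q p := by
      rw [htab T, htab T', ← hq, ← hq', h2]
      funext i
      rw [Function.comp_apply, swap_apply_def]
      grind
    rw [this, antisymm_comp_swap T hqp hcol]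
    exact Submodule.neg_mem _ hself
  · rw [antisymm_eq_zero T hqp hcol]
    · exact Submodule.zero_mem _
    · rw [htab T', ← hq']
      simp only [if_neg (Ne.symm h1), if_neg (Ne.symm h2)]

theorem not_isTrivial_standard : ¬ (spechtRep n (standardShape n hn)).IsTrivial := by
  intro h
  have hnt := nontrivial_spechtModule (card_standardShape hn)
  have hn' : (2 : ℝ) ≤ n := by exact_mod_cast hn
  have h1 := aCoeff_spechtRep hn (card_standardShape hn)
  have h2 : charRatio (V := spechtModule n (standardShape n hn)) (spechtRep n (standardShape n hn))
      (transpositions n hn) = 1 :=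
    charRatio_of_isTrivial (V := spechtModule n (standardShape n hn)) h _
  rw [aCoeff, h2, sub_self, swapDefect_standardShape] at h1
  have : (0 : ℝ) < 2 * n / (n * (n - 1)) :=
    div_pos (by linarith) (mul_pos (by linarith) (by linarith))
  linarith

theorem tTerm_threeCycle_standard {a b c : Fin n} (hab : a ≠ b) (hac : a ≠ c) (hbc : b ≠ c) :
    tTerm (V := spechtModule n (standardShape n hn)) (transpositions n hn)
      (spechtRep n (standardShape n hn)) (ConjClasses.mk (swap a b * swap a c)) = -3 / 2 := by
  have hn' : (3 : ℝ) ≤ n := by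
    simpa using natCast_ge_of_nodup (l := [a, b, c]) (by simp [hab, hac, hbc])
  have h1 : (n : ℝ) ≠ 0 := by linarith
  have h3 : (n - 2 : ℝ) ≠ 0 := by linarith
  rw [tTerm_threeCycle_spechtRep hn (card_standardShape hn) hab hac hbc,
    swapDefect_standardShape, threeCycleDefect_standardShape]
  field_simp

theorem tTerm_doubleSwap_standard {a b c d : Fin n} (hd : [a, b, c, d].Nodup) :
    tTerm (V := spechtModule n (standardShape n hn)) (transpositions n hn)
      (spechtRep n (standardShape n hn)) (ConjClasses.mk (swap a b * swap c d)) = -2 := by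
  have hn' : (4 : ℝ) ≤ n := by simpa using natCast_ge_of_nodup hd
  have h1 : (n : ℝ) ≠ 0 := by linarith
  have h3 : (n - 2 : ℝ) ≠ 0 := by linarith
  have h4 : (n - 3 : ℝ) ≠ 0 := by linarith
  rw [tTerm_doubleSwap_spechtRep hn (card_standardShape hn) hd
    (by rw [swapDefect_standardShape]; exact h1), swapDefect_standardShape,
    threeCycleDefect_standardShape]
  field_simp
  ring

end Standard

end FulmanBound

end

open FulmanBound in
theorem mainTheorem1 (n : ℕ) (hn : 2 ≤ n) :
    -- monotonicity with respect to the succession order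
    (∀ lam mu : YoungDiagram, lam.card = n → mu.card = n →
      ¬ (spechtRep n lam).IsTrivial → ¬ (spechtRep n mu).IsTrivial → Succeeds lam mu →
      errorTerm (V := spechtModule n lam) (transpositions n hn) (spechtRep n lam) ≤
        errorTerm (V := spechtModule n mu) (transpositions n hn) (spechtRep n mu)) ∧
    -- `(n - 1, 1)` gives a nontrivial irreducible representation, and it minimizes the error term
    -- over all nontrivial irreducible representations
    (Representation.IsIrreducible (k := ℂ) (V := spechtModule n (standardShape n hn))
        (spechtRep n (standardShape n hn)) ∧
      ¬ (spechtRep n (standardShape n hn)).IsTrivial ∧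
      ∀ (V : Type*) [AddCommGroup V] [Module ℂ V] [FiniteDimensional ℂ V]
        (ρ : Representation ℂ (Equiv.Perm (Fin n)) V), ρ.IsIrreducible → ¬ ρ.IsTrivial →
        errorTerm (V := spechtModule n (standardShape n hn)) (transpositions n hn)
            (spechtRep n (standardShape n hn)) ≤
          errorTerm (transpositions n hn) ρ) := by
  refine ⟨?_, isIrreducible_standard hn, not_isTrivial_standard hn, ?_⟩
  · intro lam mu hlam hmu hlt hmt h
    have hcard : lam.card = mu.card := hlam.trans hmu.symm
    have hD := swapDefect_pos hn hlam hlt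
    have hD' := swapDefect_pos hn hmu hmt
    refine errorTerm_transpositions_le (V := spechtModule n lam) (W := spechtModule n mu) hn
      hlt hmt ?_ ?_
    · intro a b c hab hac hbc
      have hn' : (3 : ℝ) ≤ n := by
        simpa using natCast_ge_of_nodup (l := [a, b, c]) (by simp [hab, hac, hbc])
      rw [tTerm_threeCycle_spechtRep hn hlam hab hac hbc,
        tTerm_threeCycle_spechtRep hn hmu hab hac hbc, neg_le_neg_iff]
      exact mul_le_mul_of_nonneg_left (threeCycleDefect_div_le hcard hD hD' h)
        (div_nonneg (by norm_num) (by linarith))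
    · intro a b c d hd
      have hn' : (4 : ℝ) ≤ n := by simpa using natCast_ge_of_nodup hd
      rw [tTerm_doubleSwap_spechtRep hn hlam hd hD.ne',
        tTerm_doubleSwap_spechtRep hn hmu hd hD'.ne']
      have := swapDefect_add_le hcard hD hD' h
      exact div_le_div_of_nonneg_right (by linarith) (mul_nonneg (by linarith) (by linarith))
  -- The standard shape attains the lower bounds -3/2 and -2 valid for every nontrivial
  -- representation.
  · intro V _ _ _ ρ _ hρ
    refine errorTerm_transpositions_le (V := spechtModule n (standardShape n hn)) hn
      (not_isTrivial_standard hn) hρ ?_ ?_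
    · intro a b c hab hac hbc
      rw [tTerm_threeCycle_standard hn hab hac hbc]
      exact tTerm_threeCycle_ge hn hρ hab hac hbc
    · intro a b c d hd
      rw [tTerm_doubleSwap_standard hn hd]
      exact tTerm_doubleSwap_ge hn hρ hd
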